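/- Let $(X,d)$ be a metric space with at least two points, equipped with a complete Borel measure $\mu$, the completion of its restriction to the Borel sets, such that $0<\mu(B)<\infty$ for all open balls $B=B(x,r)$, $x\in X$, $r>0$, and such that $\mu$ is doubling: there is $c_\mu>1$ with $\mu(B(x,2r))\le c_\mu\,\mu(B(x,r))$ for all $x\in X$, $r>0$. Assume that $X$ is geodesic, i.e. every two distinct points are joined by a rectifiable curve whose length equals their distance. Let $1<p<\infty$ and $0<\beta\le 1$. Write $u_B=\frac1{\mu(B)}\int_B u\,d\mu$, and let $\mathrm{Lip}_\beta(X)$ be the set of functions $u:X\to\mathbb R$ for which there is $\kappa\ge 0$ with $|u(x)-u(y)|\le\kappa\, d(x,y)^\beta$ for all $x,y\in X$. A $\mathcal D$-structure in $X$ with exponents $p$ and $\beta$ is a family $\mathcal D=\{\mathcal D(u):u\in\mathrm{Lip}_\beta(X)\}$ of nonempty sets $\mathcal D(u)$ of measurable functions $X\to[0,\infty]$ such that: (D1) there are $K>0$ and $\tau\ge1$ such that for all $u\in \mathrm{Lip}_\beta(X)$, $g\in\mathcal D(u)$ and all balls $B=B(x,r)$, with $\tau B=B(x,\tau r)$, $$\frac1{\mu(B)}\int_B|u-u_B|\,d\mu\le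 K^{1/p}\,\mathrm{diam}(B)^\beta\Big(\frac1{\mu(\tau B)}\int_{\tau B}g^p\,d\mu\Big)^{1/p};$$ and, for all $u,v\in\mathrm{Lip}_\beta(X)$: (D2) $|a|g\in\mathcal D(au)$ if $a\in\mathbb R$ and $g\in\mathcal D(u)$ (with $0\cdot\infty=0$); (D3) $g_u+g_v\in\mathcal D(u+v)$ if $g_u\in\mathcal D(u)$ and $g_v\in\mathcal D(v)$; (D4) if $|v(x)-v(y)|\le\kappa\, d(x,y)^\beta$ for all $x,y\in X$, where $\kappa\ge0$, and $v=u$ on $X\setminus E$ for a Borel set $E$, then $\kappa\mathbf 1_E+g_u\mathbf 1_{X\setminus E}\in\mathcal D(v)$ for every $g_u\in\mathcal D(u)$. For $u\in\mathrm{Lip}_\beta(X)$ put $$\|u\|_{W^p_\beta(X,\mathcal D)}=\Big(\|u\|_{L^p(X)}^p+\inf_{g\in\mathcal D(u)}\|g\|_{L^p(X)}^p\Big)^{1/p}\in[0,\infty],$$ and let $W^p_\beta(X,\mathcal D)$ be the completion of the normed space of all $u\in\mathrm{Lip}_\beta(X)$ with $\|u\|_{W^p_\beta(X,\mathcal D)}<\infty$;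 this normed space is denoted $W^p_\beta(X,\mathcal D)\cap\mathrm{Lip}_\beta(X)$. Let $\mathcal D_H(u)$ be the set of all measurable $g:X\to[0,\infty]$ for which there is a null set $N\subset X$ with $|u(x)-u(y)|\le d(x,y)^\beta(g(x)+g(y))$ for all $x,y\in X\setminus N$. This defines a $\mathcal D$-structure $\mathcal D_H$ with exponents $p$ and $\beta$, and $M^{\beta,p}(X)=W^p_\beta(X,\mathcal D_H)$ is the Hajłasz–Sobolev space. Finally, for $u\in\mathrm{Lip}_\beta(X)$ and $x\in X$, let $$M^{\sharp,p}_\beta u(x)=\sup_{B\ni x}\Big(\frac1{\mathrm{diam}(B)^{\beta p}}\,\frac1{\mu(B)}\int_B|u-u_B|^p\,d\mu\Big)^{1/p},$$ the supremum being over all balls $B$ that contain $x$. Let $\mathcal D_A$ be a $\mathcal D$-structure in $X$ with exponents $p$ and $\beta$, and suppose that there is $\eta>0$ such that $\eta M^{\sharp,p}_\beta u\in\mathcal D_A(u)$ for every $u\in\mathrm{Lip}_\beta(X)$. Then there is a constant $C\ge1$ such that $$C^{-1}\|u\|_{W^p_\beta(X,\mathcal D_A)}\le\|u\|_{M^{\beta,p}(X)}\le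 C\|u\|_{W^p_\beta(X,\mathcal D_A)}\qquad\text{for all }u\in\mathrm{Lip}_\beta(X)$$ (the norms may be infinite). Moreover $W^p_\beta(X,\mathcal D_A)\cap\mathrm{Lip}_\beta(X)=M^{\beta,p}(X)\cap\mathrm{Lip}_\beta(X)$, and there is a unique Banach space isomorphism (a linear bijection, bounded with bounded inverse) between $W^p_\beta(X,\mathcal D_A)$ and $M^{\beta,p}(X)$ which is the identity on $W^p_\beta(X,\mathcal D_A)\cap\mathrm{Lip}_\beta(X)=M^{\beta,p}(X)\cap\mathrm{Lip}_\beta(X)$. -/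

import Mathlib

open MeasureTheory Metric Set
open scoped ENNReal NNReal

/-- The standing assumptions on a metric measure space `(X, d, μ)`: it has at least two points,
every ball has positive and finite measure, and `μ` is doubling.  The (complete) measure of the
theory is the completion of the Borel measure `μ`; measurability with respect to it is
expressed by `AEMeasurable`. -/
class IsDoublingSpace {X : Type*} [MetricSpace X] [MeasurableSpace X] (μ : Measure X) : Prop where
  nontrivial : Nontrivial X
  measure_ball_pos : ∀ (x : X) (r : ℝ), 0 < r → 0 < μ (ball x r)
  measure_ball_lt_top : ∀ (x : X) (r : ℝ), 0 < r → μ (ball x r) < ∞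
  doubling : ∃ c : ℝ≥0, 1 < c ∧ ∀ (x : X) (r : ℝ), 0 < r → μ (ball x (2 * r)) ≤ c * μ (ball x r)

/-- Every two points are joined by a (rectifiable) curve whose length is their distance. -/
def IsGeodesicSpace (X : Type*) [MetricSpace X] : Prop :=
  ∀ x y : X, x ≠ y → ∃ (a b : ℝ) (γ : ℝ → X), a ≤ b ∧ ContinuousOn γ (Icc a b) ∧
    γ a = x ∧ γ b = y ∧ eVariationOn γ (Icc a b) = edist x y

section

variable {X : Type*} [MetricSpace X] [MeasurableSpace X]

/-- The fractional sharp maximal function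
`sup_{B ∋ x} (diam(B)^{-βp} ⨍_B |u - u_B|^p dμ)^{1/p}`, the supremum being over all balls. -/
noncomputable def sharpMaximal (μ : Measure X) (p : ℝ) (β : ℝ≥0) (u : X → ℝ) (x : X) : ℝ≥0∞ :=
  ⨆ (z : X) (r : ℝ) (_ : 0 < r) (_ : x ∈ ball z r),
    ((⨍⁻ y in ball z r, ‖u y - ⨍ w in ball z r, u w ∂μ‖ₑ ^ p ∂μ) /
      ENNReal.ofReal (diam (ball z r)) ^ ((β : ℝ) * p)) ^ (1 / p)

/-- A `𝒟`-structure with exponents `1 ≤ p < ∞` and `0 < β ≤ 1`.  The values of `toFun` at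
functions that are not `β`-Hölder play no role. -/
structure DStructure (μ : Measure X) (p : ℝ) (β : ℝ≥0) where
  toFun : (X → ℝ) → Set (X → ℝ≥0∞)
  one_le_p : 1 ≤ p
  beta_pos : 0 < β
  beta_le_one : β ≤ 1
  nonempty : ∀ u, MemHolder β u → (toFun u).Nonempty
  aemeasurable : ∀ u, MemHolder β u → ∀ g ∈ toFun u, AEMeasurable g μ
  poincare : ∃ K τ : ℝ, 0 < K ∧ 1 ≤ τ ∧ ∀ u, MemHolder β u → ∀ g ∈ toFun u,
    ∀ (x : X) (r : ℝ), 0 < r →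
      ⨍⁻ y in ball x r, ‖u y - ⨍ w in ball x r, u w ∂μ‖ₑ ∂μ ≤
        ENNReal.ofReal (K ^ (1 / p) * diam (ball x r) ^ (β : ℝ)) *
          (⨍⁻ y in ball x (τ * r), g y ^ p ∂μ) ^ (1 / p)
  smul_mem : ∀ u, MemHolder β u → ∀ (a : ℝ), ∀ g ∈ toFun u, (fun x => ‖a‖ₑ * g x) ∈ toFun (a • u)
  add_mem : ∀ u v, MemHolder β u → MemHolder β v → ∀ g ∈ toFun u, ∀ h ∈ toFun v,
    g + h ∈ toFun (u + v)
  glue_mem : ∀ u v, MemHolder β u → ∀ κ : ℝ≥0, HolderWith κ β v → ∀ E : Set X,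
    MeasurableSet E → (∀ x ∉ E, v x = u x) → ∀ g ∈ toFun u,
      (E.indicator (fun _ => (κ : ℝ≥0∞)) + Eᶜ.indicator g) ∈ toFun v

namespace DStructure

variable {μ : Measure X} {p : ℝ} {β : ℝ≥0}

/-- The (extended-valued) Sobolev norm
`(‖u‖_p^p + inf_{g ∈ 𝒟(u)} ‖g‖_p^p)^{1/p}` of a Hölder function `u`. -/
noncomputable def sobolevNorm (D : DStructure μ p β) (u : X → ℝ) : ℝ≥0∞ :=
  (∫⁻ x, ‖u x‖ₑ ^ p ∂μ + ⨅ g ∈ D.toFun u, ∫⁻ x, g x ^ p ∂μ) ^ (1 / p)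

theorem p_pos (D : DStructure μ p β) : 0 < p := zero_lt_one.trans_le D.one_le_p

theorem continuous_of_memHolder (D : DStructure μ p β) {u : X → ℝ} (hu : MemHolder β u) :
    Continuous u := by
  obtain ⟨C, hC⟩ := hu
  exact hC.continuous D.beta_pos

theorem sobolevNorm_le (D : DStructure μ p β) {u : X → ℝ} {g : X → ℝ≥0∞}
    (hg : g ∈ D.toFun u) :
    D.sobolevNorm u ≤ (∫⁻ x, ‖u x‖ₑ ^ p ∂μ + ∫⁻ x, g x ^ p ∂μ) ^ (1 / p) := by
  have hp := D.p_pos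
  unfold sobolevNorm
  gcongr
  exact iInf₂_le g hg

theorem exists_lt (D : DStructure μ p β) {u : X → ℝ} (hu : MemHolder β u) {c : ℝ≥0∞}
    (h : D.sobolevNorm u < c) :
    ∃ g ∈ D.toFun u, (∫⁻ x, ‖u x‖ₑ ^ p ∂μ + ∫⁻ x, g x ^ p ∂μ) ^ (1 / p) < c := by
  have hp := D.p_pos
  have : Nonempty (D.toFun u) := (D.nonempty u hu).to_subtype
  unfold sobolevNorm at h
  rw [iInf_subtype', ENNReal.add_iInf, one_div, ENNReal.rpow_inv_lt_iff hp, iInf_lt_iff] at h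
  obtain ⟨g, hg⟩ := h
  exact ⟨g, g.2, by rwa [one_div, ENNReal.rpow_inv_lt_iff hp]⟩

theorem sobolevNorm_zero (D : DStructure μ p β) : D.sobolevNorm 0 = 0 := by
  have hp := D.p_pos
  have h0 : MemHolder β (0 : X → ℝ) := memHolder_zero
  obtain ⟨g, hg⟩ := D.nonempty 0 h0
  have h := D.smul_mem 0 h0 0 g hg
  have h2 := D.sobolevNorm_le h
  simpa [hp] using h2

theorem sobolevNorm_smul_le (D : DStructure μ p β) {u : X → ℝ} (hu : MemHolder β u) (a : ℝ) :
    D.sobolevNorm (a • u) ≤ ‖a‖ₑ * D.sobolevNorm u := by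
  have hp := D.p_pos
  by_cases ha : a = 0
  · simp [ha, D.sobolevNorm_zero]
  have ha' : ‖a‖ₑ ≠ 0 := by simpa using ha
  refine ENNReal.le_of_forall_pos_le_add fun ε hε hfin => ?_
  have hlt : D.sobolevNorm u < D.sobolevNorm u + ε / ‖a‖ₑ := by
    refine ENNReal.lt_add_right ?_ ?_
    · rintro h
      simp [h, ENNReal.mul_top ha'] at hfin
    · simp [hε.ne']
  obtain ⟨g, hg, hlt'⟩ := D.exists_lt hu hlt
  calc D.sobolevNorm (a • u)
      ≤ (∫⁻ x, ‖(a • u) x‖ₑ ^ p ∂μ + ∫⁻ x, (‖a‖ₑ * g x) ^ p ∂μ) ^ (1 / p) :=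
        D.sobolevNorm_le (D.smul_mem u hu a g hg)
    _ = ‖a‖ₑ * (∫⁻ x, ‖u x‖ₑ ^ p ∂μ + ∫⁻ x, g x ^ p ∂μ) ^ (1 / p) := by
        simp only [Pi.smul_apply, smul_eq_mul, enorm_mul, ENNReal.mul_rpow_of_nonneg _ _ hp.le]
        have ht : ‖a‖ₑ ^ p ≠ ∞ := ENNReal.rpow_ne_top_of_nonneg hp.le enorm_ne_top
        rw [lintegral_const_mul' _ _ ht, lintegral_const_mul' _ _ ht, ← mul_add,
          ENNReal.mul_rpow_of_nonneg _ _ (by positivity), ← ENNReal.rpow_mul,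
          mul_one_div_cancel hp.ne', ENNReal.rpow_one]
    _ ≤ ‖a‖ₑ * (D.sobolevNorm u + ε / ‖a‖ₑ) := by gcongr
    _ = ‖a‖ₑ * D.sobolevNorm u + ε := by
        rw [mul_add, ENNReal.mul_div_cancel ha' enorm_ne_top]

theorem sobolevNorm_smul (D : DStructure μ p β) {u : X → ℝ} (hu : MemHolder β u) (a : ℝ) :
    D.sobolevNorm (a • u) = ‖a‖ₑ * D.sobolevNorm u := by
  refine (D.sobolevNorm_smul_le hu a).antisymm ?_
  by_cases ha : a = 0
  · simp [ha]
  have ha' : ‖a‖ₑ ≠ 0 := by simpa using ha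
  have h := D.sobolevNorm_smul_le (hu.smul (c := a)) a⁻¹
  rw [smul_smul, inv_mul_cancel₀ ha, one_smul, enorm_inv ha] at h
  calc ‖a‖ₑ * D.sobolevNorm u ≤ ‖a‖ₑ * (‖a‖ₑ⁻¹ * D.sobolevNorm (a • u)) := by gcongr
    _ = D.sobolevNorm (a • u) := by
      rw [← mul_assoc, ENNReal.mul_inv_cancel ha' enorm_ne_top, one_mul]

theorem minkowski_pair {X : Type*} [MeasurableSpace X] {μ : Measure X}
    {f₁ f₂ g₁ g₂ : X → ℝ≥0∞} (hp : 1 ≤ p) (hf₁ : AEMeasurable f₁ μ) (hf₂ : AEMeasurable f₂ μ) (hg₁ : AEMeasurable g₁ μ) (hg₂ : AEMeasurable g₂ μ) :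
    (∫⁻ x, (f₁ + f₂) x ^ p ∂μ + ∫⁻ x, (g₁ + g₂) x ^ p ∂μ) ^ (1 / p) ≤
      (∫⁻ x, f₁ x ^ p ∂μ + ∫⁻ x, g₁ x ^ p ∂μ) ^ (1 / p) +
        (∫⁻ x, f₂ x ^ p ∂μ + ∫⁻ x, g₂ x ^ p ∂μ) ^ (1 / p) := by
  have hp0 : 0 < p := by linarith
  have key : ∀ a : ℝ≥0∞, (a ^ (1 / p)) ^ p = a := fun a => by
    rw [← ENNReal.rpow_mul, one_div_mul_cancel hp0.ne', ENNReal.rpow_one]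
  have h1 := ENNReal.rpow_le_rpow (ENNReal.lintegral_Lp_add_le hf₁ hf₂ hp) hp0.le
  have h2 := ENNReal.rpow_le_rpow (ENNReal.lintegral_Lp_add_le hg₁ hg₂ hp) hp0.le
  rw [key] at h1 h2
  have h3 := ENNReal.Lp_add_le (Finset.univ : Finset (Fin 2))
    ![(∫⁻ x, f₁ x ^ p ∂μ) ^ (1 / p), (∫⁻ x, g₁ x ^ p ∂μ) ^ (1 / p)]
    ![(∫⁻ x, f₂ x ^ p ∂μ) ^ (1 / p), (∫⁻ x, g₂ x ^ p ∂μ) ^ (1 / p)] hp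
  simp only [Fin.sum_univ_two, Matrix.cons_val_zero, Matrix.cons_val_one, key] at h3
  exact (ENNReal.rpow_le_rpow (add_le_add h1 h2) (by positivity)).trans h3

theorem sobolevNorm_add_le [BorelSpace X] (D : DStructure μ p β) {u v : X → ℝ}
    (hu : MemHolder β u) (hv : MemHolder β v) :
    D.sobolevNorm (u + v) ≤ D.sobolevNorm u + D.sobolevNorm v := by
  have hp := D.p_pos
  refine ENNReal.le_of_forall_pos_le_add fun ε hε hfin => ?_
  rw [ENNReal.add_lt_top] at hfin
  have hε2 : ((ε : ℝ≥0∞) / 2) ≠ 0 := by simp [hε.ne']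
  obtain ⟨g, hg, hg'⟩ := D.exists_lt hu (ENNReal.lt_add_right hfin.1.ne hε2)
  obtain ⟨h, hh, hh'⟩ := D.exists_lt hv (ENNReal.lt_add_right hfin.2.ne hε2)
  have mu : AEMeasurable (fun x => ‖u x‖ₑ) μ :=
    (D.continuous_of_memHolder hu).measurable.enorm.aemeasurable
  have mv : AEMeasurable (fun x => ‖v x‖ₑ) μ :=
    (D.continuous_of_memHolder hv).measurable.enorm.aemeasurable
  calc D.sobolevNorm (u + v)
      ≤ (∫⁻ x, ‖(u + v) x‖ₑ ^ p ∂μ + ∫⁻ x, (g + h) x ^ p ∂μ) ^ (1 / p) :=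
        D.sobolevNorm_le (D.add_mem u v hu hv g hg h hh)
    _ ≤ (∫⁻ x, ((fun x => ‖u x‖ₑ) + (fun x => ‖v x‖ₑ)) x ^ p ∂μ +
          ∫⁻ x, (g + h) x ^ p ∂μ) ^ (1 / p) := by
        gcongr with x
        exact enorm_add_le _ _
    _ ≤ _ := minkowski_pair D.one_le_p mu mv (D.aemeasurable u hu g hg) (D.aemeasurable v hv h hh)
    _ ≤ (D.sobolevNorm u + ε / 2) + (D.sobolevNorm v + ε / 2) := add_le_add hg'.le hh'.le
    _ = D.sobolevNorm u + D.sobolevNorm v + ε := by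
        rw [add_add_add_comm, ENNReal.add_halves]

theorem eq_zero_of_sobolevNorm [BorelSpace X] [μ.IsOpenPosMeasure] (D : DStructure μ p β)
    {u : X → ℝ} (hu : MemHolder β u) (h : D.sobolevNorm u = 0) : u = 0 := by
  have hp := D.p_pos
  have hc := D.continuous_of_memHolder hu
  unfold sobolevNorm at h
  rw [ENNReal.rpow_eq_zero_iff_of_pos (by positivity)] at h
  have h1 : ∫⁻ x, ‖u x‖ₑ ^ p ∂μ = 0 := by simpa using (add_eq_zero.1 h).1
  rw [lintegral_eq_zero_iff (hc.measurable.enorm.pow_const p)] at h1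
  have h2 : u =ᵐ[μ] 0 := by
    filter_upwards [h1] with x hx
    simpa [hp, hp.not_gt] using hx
  exact (hc.ae_eq_iff_eq μ continuous_zero).1 h2

/-- The vector space of all `β`-Hölder functions with finite Sobolev norm. -/
noncomputable def holderSubmodule [BorelSpace X] (D : DStructure μ p β) :
    Submodule ℝ (X → ℝ) where
  carrier := {u | MemHolder β u ∧ D.sobolevNorm u < ∞}
  zero_mem' := ⟨memHolder_zero, by simp [D.sobolevNorm_zero]⟩
  add_mem' := fun hu hv => ⟨hu.1.add hv.1,
    (D.sobolevNorm_add_le hu.1 hv.1).trans_lt (ENNReal.add_lt_top.2 ⟨hu.2, hv.2⟩)⟩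
  smul_mem' := fun a u hu => ⟨hu.1.smul, by
    rw [D.sobolevNorm_smul hu.1]
    exact ENNReal.mul_lt_top enorm_lt_top hu.2⟩

/-- The space of Hölder functions with finite Sobolev norm, as a type of its own (so that it
carries the Sobolev norm and not the topology of pointwise convergence). -/
def HolderSobolev [BorelSpace X] (D : DStructure μ p β) : Type _ := D.holderSubmodule

/-- A Hölder function with finite Sobolev norm as an element of `HolderSobolev`. -/
def HolderSobolev.mk [BorelSpace X] (D : DStructure μ p β) (u : X → ℝ)
    (hu : u ∈ D.holderSubmodule) : D.HolderSobolev :=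
  (⟨u, hu⟩ : D.holderSubmodule)

noncomputable instance [BorelSpace X] (D : DStructure μ p β) : AddCommGroup D.HolderSobolev :=
  inferInstanceAs (AddCommGroup D.holderSubmodule)

noncomputable instance [BorelSpace X] (D : DStructure μ p β) : Module ℝ D.HolderSobolev :=
  inferInstanceAs (Module ℝ D.holderSubmodule)

noncomputable instance [BorelSpace X] (D : DStructure μ p β) : Norm D.HolderSobolev where
  norm u := (D.sobolevNorm u.1).toReal

theorem holderSobolev_core [BorelSpace X] [μ.IsOpenPosMeasure] (D : DStructure μ p β) :
    NormedSpace.Core ℝ D.HolderSobolev where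
  norm_nonneg _ := ENNReal.toReal_nonneg
  norm_smul a u := by
    change (D.sobolevNorm (a • u.1)).toReal = ‖a‖ * (D.sobolevNorm u.1).toReal
    rw [D.sobolevNorm_smul u.2.1, ENNReal.toReal_mul, toReal_enorm]
  norm_triangle u v := by
    change (D.sobolevNorm (u.1 + v.1)).toReal ≤
      (D.sobolevNorm u.1).toReal + (D.sobolevNorm v.1).toReal
    rw [← ENNReal.toReal_add u.2.2.ne v.2.2.ne]
    exact ENNReal.toReal_mono (ENNReal.add_ne_top.2 ⟨u.2.2.ne, v.2.2.ne⟩)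
      (D.sobolevNorm_add_le u.2.1 v.2.1)
  norm_eq_zero_iff u := by
    change (D.sobolevNorm u.1).toReal = 0 ↔ u = 0
    rw [ENNReal.toReal_eq_zero_iff, or_iff_left u.2.2.ne]
    constructor
    · intro h
      exact Subtype.ext (D.eq_zero_of_sobolevNorm u.2.1 h)
    · rintro rfl
      exact D.sobolevNorm_zero

noncomputable instance [BorelSpace X] [μ.IsOpenPosMeasure] (D : DStructure μ p β) :
    NormedAddCommGroup D.HolderSobolev :=
  NormedAddCommGroup.ofCore D.holderSobolev_core

noncomputable instance [BorelSpace X] [μ.IsOpenPosMeasure] (D : DStructure μ p β) :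
    NormedSpace ℝ D.HolderSobolev :=
  NormedSpace.ofCore D.holderSobolev_core

/-- The Sobolev space `W^p_β(X, 𝒟)`: the completion of the normed space of `β`-Hölder functions
with finite Sobolev norm. -/
abbrev SobolevSpace [BorelSpace X] [μ.IsOpenPosMeasure] (D : DStructure μ p β) : Type _ :=
  UniformSpace.Completion D.HolderSobolev

/-- A Hölder function with finite Sobolev norm as an element of the Sobolev space. -/
noncomputable def ofHolder [BorelSpace X] [μ.IsOpenPosMeasure] (D : DStructure μ p β) (u : X → ℝ)
    (hu : u ∈ D.holderSubmodule) : D.SobolevSpace :=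
  (HolderSobolev.mk D u hu : UniformSpace.Completion D.HolderSobolev)

end DStructure

theorem IsDoublingSpace.isOpenPosMeasure (μ : Measure X) [h : IsDoublingSpace μ] :
    μ.IsOpenPosMeasure where
  open_pos := by
    rintro U hU ⟨x, hx⟩ h0
    obtain ⟨r, hr, hs⟩ := Metric.isOpen_iff.1 hU x hx
    exact (h.measure_ball_pos x r hr).ne' (measure_mono_null hs h0)

instance (μ : Measure X) [IsDoublingSpace μ] : μ.IsOpenPosMeasure :=
  IsDoublingSpace.isOpenPosMeasure μ

/-- The family of measurable `g ≥ 0` with `|u(x) - u(y)| ≤ d(x,y)^β (g(x) + g(y))` for all `x`, `y`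
outside of a null set. -/
def hajlaszGradients (μ : Measure X) (β : ℝ≥0) (u : X → ℝ) : Set (X → ℝ≥0∞) :=
  {g | AEMeasurable g μ ∧ ∃ N : Set X, μ N = 0 ∧ ∀ x ∉ N, ∀ y ∉ N,
    edist (u x) (u y) ≤ edist x y ^ (β : ℝ) * (g x + g y)}

theorem hajlasz_poincare_aux [BorelSpace X] (μ : Measure X) [IsDoublingSpace μ] {p : ℝ} {β : ℝ≥0}
    (hp : 1 ≤ p) (hβ : 0 < β) {u : X → ℝ} (hu : MemHolder β u) {g : X → ℝ≥0∞}
    (hg : g ∈ hajlaszGradients μ β u) (x : X) {r : ℝ} (hr : 0 < r) :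
    ⨍⁻ y in ball x r, ‖u y - ⨍ w in ball x r, u w ∂μ‖ₑ ∂μ ≤
      ENNReal.ofReal (((2 : ℝ) ^ p) ^ (1 / p) * diam (ball x r) ^ (β : ℝ)) *
        (⨍⁻ y in ball x (1 * r), g y ^ p ∂μ) ^ (1 / p) := by
  have hp0 : 0 < p := by linarith
  set B := ball x r with hB
  have hpos : 0 < μ B := IsDoublingSpace.measure_ball_pos x r hr
  have htop : μ B < ∞ := IsDoublingSpace.measure_ball_lt_top x r hr
  set ν : Measure X := (μ.restrict B univ)⁻¹ • μ.restrict B with hν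
  have hprob : IsProbabilityMeasure ν := ⟨by
    rw [hν, Measure.smul_apply, smul_eq_mul, Measure.restrict_apply_univ]
    exact ENNReal.inv_mul_cancel hpos.ne' htop.ne⟩
  have hac : ν ≪ μ.restrict B := Measure.smul_absolutelyContinuous
  have hac' : ν ≪ μ := hac.trans Measure.absolutelyContinuous_restrict
  have hmemB : ∀ᵐ y ∂ν, y ∈ B := hac.ae_le (ae_restrict_mem measurableSet_ball)
  obtain ⟨hgm, N, hN, hgN⟩ := hg
  have hNν : ∀ᵐ y ∂ν, y ∉ N := measure_eq_zero_iff_ae_notMem.1 (hac' hN)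
  have hgν : AEMeasurable g ν := hgm.mono_ac hac'
  obtain ⟨C, hC⟩ := hu
  have hcont : Continuous u := hC.continuous hβ
  set Δ : ℝ≥0∞ := ENNReal.ofReal (diam B) with hΔ
  have hdist : ∀ y ∈ B, ∀ z ∈ B, edist y z ≤ Δ := fun y hy z hz => by
    rw [edist_dist]
    exact ENNReal.ofReal_le_ofReal (dist_le_diam_of_mem isBounded_ball hy hz)
  have hint : Integrable u ν := by
    refine Integrable.of_bound hcont.aestronglyMeasurable
      (‖u x‖ + (C * ENNReal.ofReal r ^ (β : ℝ)).toReal) ?_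
    filter_upwards [hmemB] with y hy
    have hfin : (C * ENNReal.ofReal r ^ (β : ℝ) : ℝ≥0∞) ≠ ∞ :=
      ENNReal.mul_ne_top ENNReal.coe_ne_top
        (ENNReal.rpow_ne_top_of_nonneg (by positivity) ENNReal.ofReal_ne_top)
    have h1 : edist (u y) (u x) ≤ C * ENNReal.ofReal r ^ (β : ℝ) := by
      refine (hC y x).trans ?_
      gcongr
      rw [edist_dist]
      exact ENNReal.ofReal_le_ofReal (mem_ball.1 hy).le
    have h2 : ‖u y - u x‖ ≤ (C * ENNReal.ofReal r ^ (β : ℝ)).toReal := by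
      rw [← dist_eq_norm, dist_edist]
      exact ENNReal.toReal_mono hfin h1
    calc ‖u y‖ = ‖u x + (u y - u x)‖ := by congr 1; ring
      _ ≤ _ := (norm_add_le _ _).trans (by gcongr)
  have hdev : ∀ y, ‖u y - ∫ w, u w ∂ν‖ₑ ≤ ∫⁻ z, edist (u y) (u z) ∂ν := fun y => by
    have : u y - ∫ w, u w ∂ν = ∫ w, (u y - u w) ∂ν := by
      rw [integral_sub (integrable_const _) hint]; simp
    rw [this]
    refine (enorm_integral_le_lintegral_enorm _).trans (le_of_eq ?_)
    simp only [edist_eq_enorm_sub]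
  have hI : ∫⁻ y, g y ∂ν ≤ (∫⁻ y, g y ^ p ∂ν) ^ (1 / p) := by
    rcases hp.eq_or_lt with rfl | hp1
    · simp
    · have h := ENNReal.lintegral_mul_le_Lp_mul_Lq ν (Real.HolderConjugate.conjExponent hp1) hgν
        (aemeasurable_const (b := (1 : ℝ≥0∞)))
      simpa using h
  have hmain : ∫⁻ y, ‖u y - ∫ w, u w ∂ν‖ₑ ∂ν ≤ 2 * Δ ^ (β : ℝ) * ∫⁻ y, g y ∂ν := by
    have hstep : ∀ᵐ y ∂ν, ‖u y - ∫ w, u w ∂ν‖ₑ ≤ Δ ^ (β : ℝ) * (g y + ∫⁻ z, g z ∂ν) := by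
      filter_upwards [hmemB, hNν] with y hy hyN
      refine (hdev y).trans ?_
      calc ∫⁻ z, edist (u y) (u z) ∂ν ≤ ∫⁻ z, Δ ^ (β : ℝ) * (g y + g z) ∂ν := by
            refine lintegral_mono_ae ?_
            filter_upwards [hmemB, hNν] with z hz hzN
            refine (hgN y hyN z hzN).trans ?_
            gcongr
            exact hdist y hy z hz
        _ = Δ ^ (β : ℝ) * (g y + ∫⁻ z, g z ∂ν) := by
            rw [lintegral_const_mul' _ _
              (ENNReal.rpow_ne_top_of_nonneg (by positivity) ENNReal.ofReal_ne_top),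
              lintegral_add_left measurable_const, lintegral_const, measure_univ, mul_one]
    calc _ ≤ ∫⁻ y, Δ ^ (β : ℝ) * (g y + ∫⁻ z, g z ∂ν) ∂ν := lintegral_mono_ae hstep
      _ = _ := by
        rw [lintegral_const_mul' _ _
          (ENNReal.rpow_ne_top_of_nonneg (by positivity) ENNReal.ofReal_ne_top),
          lintegral_add_right _ measurable_const]
        simp only [lintegral_const, measure_univ, mul_one]
        ring
  have hconst : ENNReal.ofReal (((2 : ℝ) ^ p) ^ (1 / p) * diam B ^ (β : ℝ)) =
      2 * Δ ^ (β : ℝ) := by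
    rw [← Real.rpow_mul (by norm_num), mul_one_div_cancel hp0.ne', Real.rpow_one,
      ENNReal.ofReal_mul (by norm_num), hΔ,
      ENNReal.ofReal_rpow_of_nonneg diam_nonneg (by positivity)]
    norm_num
  rw [hconst, one_mul]
  exact hmain.trans (by gcongr; exact hI)

/-- The Hajłasz `𝒟`-structure. -/
noncomputable def hajlaszStructure [BorelSpace X] (μ : Measure X) [IsDoublingSpace μ] (p : ℝ)
    (β : ℝ≥0) (hp : 1 ≤ p) (hβ : 0 < β) (hβ1 : β ≤ 1) : DStructure μ p β where
  toFun := hajlaszGradients μ β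
  one_le_p := hp
  beta_pos := hβ
  beta_le_one := hβ1
  nonempty := by
    rintro u ⟨C, hC⟩
    refine ⟨fun _ => C, aemeasurable_const, ∅, measure_empty, fun x _ y _ => ?_⟩
    calc edist (u x) (u y) ≤ C * edist x y ^ (β : ℝ) := hC x y
      _ = edist x y ^ (β : ℝ) * C := mul_comm _ _
      _ ≤ _ := by gcongr; exact le_self_add
  aemeasurable := fun u _ g hg => hg.1
  poincare := ⟨2 ^ p, 1, by positivity, le_rfl, fun u hu g hg x r hr =>
    hajlasz_poincare_aux μ hp hβ hu hg x hr⟩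
  smul_mem := by
    rintro u - a g ⟨hm, N, hN, h⟩
    refine ⟨hm.const_mul _, N, hN, fun x hx y hy => ?_⟩
    calc edist ((a • u) x) ((a • u) y) = ‖a‖ₑ * edist (u x) (u y) := by
          rw [Pi.smul_apply, Pi.smul_apply, edist_smul₀, ENNReal.smul_def, smul_eq_mul,
            enorm_eq_nnnorm]
      _ ≤ ‖a‖ₑ * (edist x y ^ (β : ℝ) * (g x + g y)) := by gcongr; exact h x hx y hy
      _ = _ := by ring
  add_mem := by
    rintro u v - - g ⟨hm, N, hN, h⟩ g' ⟨hm', N', hN', h'⟩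
    refine ⟨hm.add hm', N ∪ N', measure_union_null hN hN', fun x hx y hy => ?_⟩
    simp only [mem_union, not_or] at hx hy
    calc edist ((u + v) x) ((u + v) y) ≤ edist (u x) (u y) + edist (v x) (v y) :=
          edist_add_add_le _ _ _ _
      _ ≤ _ := add_le_add (h x hx.1 y hy.1) (h' x hx.2 y hy.2)
      _ = _ := by simp only [Pi.add_apply]; ring
  glue_mem := by
    rintro u v - κ hv E hE huv g ⟨hm, N, hN, h⟩
    refine ⟨(aemeasurable_const.indicator hE).add (hm.indicator hE.compl), N, hN,
      fun x hx y hy => ?_⟩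
    by_cases hxE : x ∈ E
    · calc edist (v x) (v y) ≤ κ * edist x y ^ (β : ℝ) := hv x y
        _ = edist x y ^ (β : ℝ) * κ := mul_comm _ _
        _ ≤ _ := by
          gcongr
          simp [hxE]
    · by_cases hyE : y ∈ E
      · calc edist (v x) (v y) ≤ κ * edist x y ^ (β : ℝ) := hv x y
          _ = edist x y ^ (β : ℝ) * κ := mul_comm _ _
          _ ≤ _ := by
            gcongr
            simp [hyE]
      · rw [huv x hxE, huv y hyE]
        simpa [hxE, hyE] using h x hx y hy

end

/-! ### Doubling measures and a covering argument of Vitali type. -/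

section Doubling

variable {X : Type*} [MetricSpace X] [MeasurableSpace X]

/-! Let f be `oscMaximal μ β u`, the supremum of r^{-β} ⨍_B |u - u_B| over the balls B of radius r
containing the point. Everything rests on one estimate, valid for every 𝒟-structure with p > 1: ∫
f^p ≤ C ∫ g^p for all g ∈ 𝒟(u) (`exists_lintegral_oscMaximal_rpow_le`).

It gives both norm inequalities. Telescoping averages over shrinking balls shows that a constant
multiple of f is a Hajłasz gradient (`exists_edist_le_oscMaximal`), so the Hajłasz norm is dominated
by the norm of any 𝒟-structure. Conversely, a Sobolev–Poincaré inequality bounds `sharpMaximal` by a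
multiple of M(f^q)^{1/q} with q < p, where M is the Hardy–Littlewood maximal operator. As p/q > 1,
the L^p-norm of `sharpMaximal` is at most that of f, hence at most that of any Hajłasz gradient, up
to constants; and η times `sharpMaximal` is admissible for `A`. Equivalent norms on the same Hölder
functions then extend to isomorphic completions.

The estimate for f is proved level by level. Fix l and k and put t_j = 2^{k+j} l for j < k. On {f ≤
t_j} the function u is Hölder with constant C t_j; let v_j be its extension with that constant and h
the average of v_0, ..., v_{k-1}. By gluing, h has the gradient k^{-1} Σ_j (C t_j 1_{f > t_j} + g
1_{f ≤ t_j}). A Whitney-type covering controls u - h, and Poincaré's inequality controls the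
oscillation of h. As the t_j grow geometrically, the p-th power of k^{-1} Σ t_j 1_{f > t_j} is at
most a constant times k^{-p} Σ t_j^p 1_{f > t_j}. Covering {f > l} by balls of large oscillation
gives l^p μ(f > l) ≤ C k^{-p} Σ_j t_j^p μ(f > t_j) + C ∫_{f ≈ l} g^p. Let S be the sum of the left
side over dyadic l. Then S ≤ C k^{1-p} S + C_k ∫ g^p, and since p > 1 a large k lets the first term
be absorbed. -/

theorem measure_ball_ne_zero (μ : Measure X) [h : IsDoublingSpace μ] {x : X} {r : ℝ} (hr : 0 < r) :
    μ (ball x r) ≠ 0 := (h.measure_ball_pos x r hr).ne'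

theorem measure_ball_ne_top (μ : Measure X) [h : IsDoublingSpace μ] {x : X} {r : ℝ} :
    μ (ball x r) ≠ ∞ := by
  rcases le_or_gt r 0 with hr | hr
  · simp [ball_eq_empty.2 hr]
  · exact (h.measure_ball_lt_top x r hr).ne

/-- Rounding the doubling constant up to a power of 2 makes s act as a dimension, to be balanced
against β in the Sobolev–Poincaré inequality. -/
theorem exists_doubling_exponent (μ : Measure X) [h : IsDoublingSpace μ] :
    ∃ s : ℕ, 0 < s ∧ ∀ (x : X) (r : ℝ), 0 < r → μ (ball x (2 * r)) ≤ 2 ^ s * μ (ball x r) := by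
  obtain ⟨c, hc, hd⟩ := h.doubling
  obtain ⟨s, hs⟩ := pow_unbounded_of_one_lt c (one_lt_two (α := ℝ≥0))
  refine ⟨s, Nat.pos_of_ne_zero ?_, fun x r hr => (hd x r hr).trans ?_⟩
  · rintro rfl
    simp at hs
    exact absurd hc (not_lt.2 hs.le)
  · gcongr
    exact_mod_cast hs.le

theorem measure_ball_two_pow_le {μ : Measure X} {s : ℕ}
    (hs : ∀ (x : X) (r : ℝ), 0 < r → μ (ball x (2 * r)) ≤ 2 ^ s * μ (ball x r))
    (n : ℕ) {x : X} {r : ℝ} (hr : 0 < r) :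
    μ (ball x (2 ^ n * r)) ≤ 2 ^ (s * n) * μ (ball x r) := by
  induction n with
  | zero => simp
  | succ n ih =>
    calc μ (ball x (2 ^ (n + 1) * r)) = μ (ball x (2 * (2 ^ n * r))) := by ring_nf
      _ ≤ 2 ^ s * μ (ball x (2 ^ n * r)) := hs x _ (by positivity)
      _ ≤ 2 ^ s * (2 ^ (s * n) * μ (ball x r)) := by gcongr
      _ = _ := by ring

theorem exists_measure_ball_mul_le (μ : Measure X) [IsDoublingSpace μ] (T : ℝ) :
    ∃ C : ℝ≥0, ∀ (x : X) (r : ℝ), 0 < r → μ (ball x (T * r)) ≤ C * μ (ball x r) := by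
  obtain ⟨s, -, hs⟩ := exists_doubling_exponent μ
  obtain ⟨n, hn⟩ := pow_unbounded_of_one_lt T (one_lt_two (α := ℝ))
  refine ⟨2 ^ (s * n), fun x r hr => ?_⟩
  push_cast
  refine le_trans (measure_mono (ball_subset_ball ?_)) (measure_ball_two_pow_le hs n hr)
  gcongr

theorem IsDoublingSpace.sigmaFinite (μ : Measure X) [h : IsDoublingSpace μ] : SigmaFinite μ := by
  obtain ⟨x⟩ := h.nontrivial.to_nonempty
  exact ⟨⟨⟨fun n => ball x n, fun _ => trivial,
    fun n => (measure_ball_ne_top μ).lt_top, iUnion_ball_nat x⟩⟩⟩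

/-- A covering argument: if every point of `S` lies in a ball `B` with
`∫_{5B} w ≤ ∫_B G`, then `∫_S w ≤ ∫ G`. -/
theorem lintegral_le_of_ball_covering [BorelSpace X] (μ : Measure X) [IsDoublingSpace μ]
    {S : Set X} {w G : X → ℝ≥0∞}
    (h : ∀ x ∈ S, ∃ (z : X) (r : ℝ), 0 < r ∧ x ∈ ball z r ∧
      ∫⁻ y in ball z (5 * r), w y ∂μ ≤ ∫⁻ y in ball z r, G y ∂μ) :
    ∫⁻ y in S, w y ∂μ ≤ ∫⁻ y, G y ∂μ := by
  have := IsDoublingSpace.sigmaFinite μ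
  -- Vitali's lemma needs bounded radii, hence the truncation at n; monotone convergence along the
  -- increasing unions `T n` removes it. No measurability of S is needed.
  set P : ℕ → Set (X × ℝ) := fun n => {a | 0 < a.2 ∧ a.2 ≤ n ∧
    ∫⁻ y in ball a.1 (5 * a.2), w y ∂μ ≤ ∫⁻ y in ball a.1 a.2, G y ∂μ} with hP
  set T : ℕ → Set X := fun n => ⋃ a ∈ P n, ball a.1 a.2 with hT
  have hmono : Monotone T := fun m n hmn => by
    refine biUnion_subset_biUnion_left fun a ha => ⟨ha.1, ha.2.1.trans ?_, ha.2.2⟩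
    exact_mod_cast hmn
  have hS : S ⊆ ⋃ n, T n := fun x hx => by
    obtain ⟨z, r, hr, hxr, hle⟩ := h x hx
    obtain ⟨n, hn⟩ := exists_nat_ge r
    exact mem_iUnion.2 ⟨n, mem_iUnion₂.2 ⟨(z, r), ⟨hr, hn, hle⟩, hxr⟩⟩
  refine (lintegral_mono_set hS).trans ?_
  rw [setLIntegral_iUnion_of_directed _ hmono.directed_le]
  refine iSup_le fun n => ?_
  -- The factor 4 is for closed balls; a closed ball of radius 4r lies in the open ball of radius
  -- 5r.
  obtain ⟨v, hvP, hdisj, hcov⟩ := Vitali.exists_disjoint_subfamily_covering_enlargement_closedBall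
    (P n) (fun a => a.1) (fun a => a.2) n (fun a ha => ha.2.1) 4 (by norm_num)
  have hdisj' : Pairwise (Function.onFun Disjoint fun a : v => ball a.1.1 a.1.2) := fun a b hab =>
    (hdisj a.2 b.2 (fun h => hab (Subtype.ext h))).mono ball_subset_closedBall
      ball_subset_closedBall
  -- Disjoint sets of positive measure in a σ-finite space are countably many.
  have hcount : Countable v := by
    have h1 := Measure.countable_meas_pos_of_disjoint_iUnion (μ := μ)
      (As := fun a : v => ball a.1.1 a.1.2) (fun a => measurableSet_ball) hdisj'
    have h2 : {a : v | 0 < μ (ball a.1.1 a.1.2)} = univ := eq_univ_of_forall fun a =>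
      (measure_ball_ne_zero μ (hvP a.2).1).bot_lt
    rw [h2] at h1
    exact countable_univ_iff.1 h1
  have hsub : T n ⊆ ⋃ a : v, ball a.1.1 (5 * a.1.2) := fun x hx => by
    obtain ⟨a, ha, hxa⟩ := mem_iUnion₂.1 hx
    obtain ⟨b, hb, hab⟩ := hcov a ha
    refine mem_iUnion.2 ⟨⟨b, hb⟩, closedBall_subset_ball ?_ (hab (ball_subset_closedBall hxa))⟩
    have := (hvP hb).1
    linarith
  calc ∫⁻ y in T n, w y ∂μ ≤ ∫⁻ y in ⋃ a : v, ball a.1.1 (5 * a.1.2), w y ∂μ :=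
        lintegral_mono_set hsub
    _ ≤ ∑' a : v, ∫⁻ y in ball a.1.1 (5 * a.1.2), w y ∂μ := lintegral_iUnion_le _ _
    _ ≤ ∑' a : v, ∫⁻ y in ball a.1.1 a.1.2, G y ∂μ := ENNReal.tsum_le_tsum fun a => (hvP a.2).2.2
    _ = ∫⁻ y in ⋃ a : v, ball a.1.1 a.1.2, G y ∂μ :=
        (lintegral_iUnion (fun a => measurableSet_ball) hdisj' _).symm
    _ ≤ ∫⁻ y, G y ∂μ := setLIntegral_le_lintegral _ _

end Doubling

/-! ### Averages over sets. -/

section Averages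

variable {X : Type*} [MeasurableSpace X] {μ : Measure X}

theorem setLAverage_le_mul_of_subset {s t : Set X} (hst : s ⊆ t) {C : ℝ≥0∞}
    (hs : μ s ≠ 0) (ht : μ t ≠ ∞) (h : μ t ≤ C * μ s) (f : X → ℝ≥0∞) :
    ⨍⁻ x in s, f x ∂μ ≤ C * ⨍⁻ x in t, f x ∂μ := by
  have hs' : μ s ≠ ∞ := ne_top_of_le_ne_top ht (measure_mono hst)
  have ht' : μ t ≠ 0 := fun h0 => hs (measure_mono_null hst h0)
  rw [setLAverage_eq, setLAverage_eq, ENNReal.div_le_iff hs hs']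
  calc ∫⁻ x in s, f x ∂μ ≤ ∫⁻ x in t, f x ∂μ := lintegral_mono_set hst
    _ = μ t * ((∫⁻ x in t, f x ∂μ) / μ t) := (ENNReal.mul_div_cancel ht' ht).symm
    _ ≤ C * μ s * ((∫⁻ x in t, f x ∂μ) / μ t) := by gcongr
    _ = _ := by ring

theorem setLAverage_mono_on {s : Set X} (hs : MeasurableSet s) {f g : X → ℝ≥0∞}
    (h : ∀ x ∈ s, f x ≤ g x) : ⨍⁻ x in s, f x ∂μ ≤ ⨍⁻ x in s, g x ∂μ := by
  rw [setLAverage_eq, setLAverage_eq]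
  gcongr ?_ / _
  exact setLIntegral_mono' hs h

theorem setLAverage_const_mul {s : Set X} {c : ℝ≥0∞} (hc : c ≠ ∞) (f : X → ℝ≥0∞) :
    ⨍⁻ x in s, c * f x ∂μ = c * ⨍⁻ x in s, f x ∂μ := by
  rw [setLAverage_eq, setLAverage_eq, lintegral_const_mul' _ _ hc, mul_div_assoc]

theorem isProbabilityMeasure_average {s : Set X} (h0 : μ s ≠ 0) (ht : μ s ≠ ∞) :
    IsProbabilityMeasure ((μ s)⁻¹ • μ.restrict s) :=
  ⟨by simp [ENNReal.inv_mul_cancel h0 ht]⟩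

theorem enorm_setAverage_sub_le {s : Set X} (h0 : μ s ≠ 0) (ht : μ s ≠ ∞) {u : X → ℝ}
    (hu : IntegrableOn u s μ) (c : ℝ) :
    ‖(⨍ x in s, u x ∂μ) - c‖ₑ ≤ ⨍⁻ x in s, ‖u x - c‖ₑ ∂μ := by
  have := isProbabilityMeasure_average h0 ht
  have hi : Integrable u ((μ s)⁻¹ • μ.restrict s) := hu.smul_measure (ENNReal.inv_ne_top.2 h0)
  rw [setAverage_eq', setLAverage_eq']
  have : (∫ x, u x ∂((μ s)⁻¹ • μ.restrict s)) - c = ∫ x, (u x - c) ∂((μ s)⁻¹ • μ.restrict s) := by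
    rw [integral_sub hi (integrable_const _)]; simp
  rw [this]
  exact enorm_integral_le_lintegral_enorm _

theorem setLAverage_le_rpow_setLAverage {s : Set X} (h0 : μ s ≠ 0) (ht : μ s ≠ ∞) {p : ℝ}
    (hp : 1 ≤ p) {f : X → ℝ≥0∞} (hf : AEMeasurable f μ) :
    ⨍⁻ x in s, f x ∂μ ≤ (⨍⁻ x in s, f x ^ p ∂μ) ^ (1 / p) := by
  have := isProbabilityMeasure_average h0 ht
  have hf' : AEMeasurable f ((μ s)⁻¹ • μ.restrict s) := (hf.restrict).smul_measure _
  rw [setLAverage_eq', setLAverage_eq']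
  rcases hp.eq_or_lt with rfl | hp1
  · simp
  · have h := ENNReal.lintegral_mul_le_Lp_mul_Lq _ (Real.HolderConjugate.conjExponent hp1) hf'
      (aemeasurable_const (b := (1 : ℝ≥0∞)))
    simpa using h

theorem le_setLAverage_of_forall_le {s : Set X} (hs : MeasurableSet s) (h0 : μ s ≠ 0)
    (ht : μ s ≠ ∞) {f : X → ℝ≥0∞} {c : ℝ≥0∞} (h : ∀ x ∈ s, c ≤ f x) :
    c ≤ ⨍⁻ x in s, f x ∂μ := by
  calc c = ⨍⁻ _ in s, c ∂μ := (setLAverage_const h0 ht c).symm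
    _ ≤ _ := setLAverage_mono_on hs h

theorem setLAverage_le_of_forall_le {s : Set X} (hs : MeasurableSet s) (h0 : μ s ≠ 0)
    (ht : μ s ≠ ∞) {f : X → ℝ≥0∞} {c : ℝ≥0∞} (h : ∀ x ∈ s, f x ≤ c) :
    ⨍⁻ x in s, f x ∂μ ≤ c := by
  calc ⨍⁻ x in s, f x ∂μ ≤ ⨍⁻ _ in s, c ∂μ := setLAverage_mono_on hs h
    _ = c := setLAverage_const h0 ht c

end Averages

/-! ### Noncentered maximal functions. -/

section BallSup

variable {X : Type*} [MetricSpace X]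

/-- The noncentered maximal function associated with a functional `F` of balls. -/
noncomputable def ballSup (F : X → ℝ → ℝ≥0∞) (x : X) : ℝ≥0∞ :=
  ⨆ (z : X) (r : ℝ) (_ : 0 < r) (_ : x ∈ ball z r), F z r

theorem lt_ballSup_iff {F : X → ℝ → ℝ≥0∞} {x : X} {t : ℝ≥0∞} :
    t < ballSup F x ↔ ∃ (z : X) (r : ℝ), 0 < r ∧ x ∈ ball z r ∧ t < F z r := by
  simp only [ballSup, lt_iSup_iff, exists_prop]

theorem le_ballSup {F : X → ℝ → ℝ≥0∞} {x z : X} {r : ℝ} (hr : 0 < r) (hx : x ∈ ball z r) :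
    F z r ≤ ballSup F x :=
  le_iSup_of_le z (le_iSup_of_le r (le_iSup_of_le hr (le_iSup_of_le hx le_rfl)))

theorem ballSup_le {F : X → ℝ → ℝ≥0∞} {x : X} {t : ℝ≥0∞}
    (h : ∀ (z : X) (r : ℝ), 0 < r → x ∈ ball z r → F z r ≤ t) : ballSup F x ≤ t :=
  iSup_le fun z => iSup_le fun r => iSup_le fun hr => iSup_le fun hx => h z r hr hx

/-- Because the supremum is noncentered, a superlevel set is a union of balls. Hence these maximal
functions are Borel whatever the functional F. -/
theorem isOpen_lt_ballSup (F : X → ℝ → ℝ≥0∞) (t : ℝ≥0∞) : IsOpen {x | t < ballSup F x} := by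
  have : {x | t < ballSup F x} =
      ⋃ (z : X) (r : ℝ) (_ : 0 < r ∧ t < F z r), ball z r := by
    ext x
    simp only [mem_ofPred_eq, lt_ballSup_iff, mem_iUnion, exists_prop]
    exact exists_congr fun z => exists_congr fun r => by tauto
  rw [this]
  exact isOpen_iUnion fun z => isOpen_iUnion fun r => isOpen_iUnion fun _ => isOpen_ball

theorem measurable_ballSup [MeasurableSpace X] [BorelSpace X] (F : X → ℝ → ℝ≥0∞) :
    Measurable (ballSup F) :=
  measurable_of_Ioi fun t => (isOpen_lt_ballSup F t).measurableSet

end BallSup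

/-! ### The sharp maximal function: telescoping and Hölder extensions. -/

section Oscillation

variable {X : Type*} [MetricSpace X] [MeasurableSpace X]

/-- The mean oscillation of `u` over the ball `B(z, r)`. -/
noncomputable def meanOsc (μ : Measure X) (u : X → ℝ) (z : X) (r : ℝ) : ℝ≥0∞ :=
  ⨍⁻ y in ball z r, ‖u y - ⨍ w in ball z r, u w ∂μ‖ₑ ∂μ

/-- The fractional sharp maximal function `sup_{B(z, r) ∋ x} r^{-β} ⨍_{B(z, r)} |u - u_{B(z, r)}|`. -/
noncomputable def oscMaximal (μ : Measure X) (β : ℝ≥0) (u : X → ℝ) : X → ℝ≥0∞ :=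
  ballSup fun z r => meanOsc μ u z r / ENNReal.ofReal r ^ (β : ℝ)

variable {μ : Measure X} {β : ℝ≥0} {u : X → ℝ}

theorem ofReal_rpow_ne_zero {r : ℝ} (hr : 0 < r) {a : ℝ} : ENNReal.ofReal r ^ a ≠ 0 :=
  (ENNReal.rpow_pos (ENNReal.ofReal_pos.2 hr) ENNReal.ofReal_ne_top).ne'

theorem ofReal_rpow_ne_top {r : ℝ} {a : ℝ} (ha : 0 ≤ a) : ENNReal.ofReal r ^ a ≠ ∞ :=
  ENNReal.rpow_ne_top_of_nonneg ha ENNReal.ofReal_ne_top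

theorem meanOsc_le_oscMaximal {x z : X} {r : ℝ} (hr : 0 < r) (hx : x ∈ ball z r) :
    meanOsc μ u z r ≤ ENNReal.ofReal r ^ (β : ℝ) * oscMaximal μ β u x := by
  rw [mul_comm, ← ENNReal.div_le_iff (ofReal_rpow_ne_zero hr) (ofReal_rpow_ne_top β.coe_nonneg)]
  exact le_ballSup (F := fun z r => meanOsc μ u z r / ENNReal.ofReal r ^ (β : ℝ)) hr hx

theorem lt_oscMaximal_iff {l : ℝ≥0∞} {x : X} :
    l < oscMaximal μ β u x ↔ ∃ (z : X) (r : ℝ), 0 < r ∧ x ∈ ball z r ∧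
      ENNReal.ofReal r ^ (β : ℝ) * l < meanOsc μ u z r := by
  rw [oscMaximal, lt_ballSup_iff]
  refine exists_congr fun z => exists_congr fun r => and_congr_right fun hr => and_congr_right fun _ => ?_
  rw [ENNReal.lt_div_iff_mul_lt (Or.inl (ofReal_rpow_ne_zero hr))
    (Or.inl (ofReal_rpow_ne_top β.coe_nonneg)), mul_comm]

theorem HolderWith.enorm_sub_le_of_mem_ball {X : Type*} [MetricSpace X] {β : ℝ≥0} {u : X → ℝ}
    {C : ℝ≥0} (hu : HolderWith C β u) {x y : X} {r : ℝ}
    (hy : y ∈ ball x r) : ‖u y - u x‖ₑ ≤ C * ENNReal.ofReal r ^ (β : ℝ) := by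
  rw [← edist_eq_enorm_sub]
  refine (hu y x).trans ?_
  gcongr
  rw [edist_dist]
  exact ENNReal.ofReal_le_ofReal (mem_ball.1 hy).le

variable [BorelSpace X] [IsDoublingSpace μ]

theorem MemHolder.integrableOn_ball (hβ : 0 < β) (hu : MemHolder β u) (z : X) (r : ℝ) :
    IntegrableOn u (ball z r) μ := by
  obtain ⟨C, hC⟩ := hu
  refine IntegrableOn.of_bound (measure_ball_ne_top μ).lt_top
    (hC.continuous hβ).aestronglyMeasurable
    (‖u z‖ + (C * ENNReal.ofReal r ^ (β : ℝ) : ℝ≥0∞).toReal) ?_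
  filter_upwards [ae_restrict_mem measurableSet_ball] with y hy
  have h2 : ‖u y - u z‖ ≤ (C * ENNReal.ofReal r ^ (β : ℝ) : ℝ≥0∞).toReal := by
    rw [← toReal_enorm]
    exact ENNReal.toReal_mono (ENNReal.mul_ne_top ENNReal.coe_ne_top (ofReal_rpow_ne_top β.coe_nonneg))
      (hC.enorm_sub_le_of_mem_ball hy)
  calc ‖u y‖ = ‖u z + (u y - u z)‖ := by congr 1; ring
    _ ≤ _ := (norm_add_le _ _).trans (by gcongr)

/-- The mean is, up to a factor 2, the best constant in the mean oscillation; this allows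
oscillations over different balls, or of different functions, to be compared. -/
theorem meanOsc_le_two_mul (hβ : 0 < β) (hu : MemHolder β u) {z : X} {r : ℝ} (hr : 0 < r) (c : ℝ) :
    meanOsc μ u z r ≤ 2 * ⨍⁻ y in ball z r, ‖u y - c‖ₑ ∂μ := by
  have h0 := measure_ball_ne_zero μ (x := z) hr
  have ht := measure_ball_ne_top μ (x := z) (r := r)
  have hm : Measurable u := by
    obtain ⟨C, hC⟩ := hu
    exact (hC.continuous hβ).measurable
  set a := ⨍ w in ball z r, u w ∂μ with ha
  have h1 : ‖a - c‖ₑ ≤ ⨍⁻ y in ball z r, ‖u y - c‖ₑ ∂μ :=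
    enorm_setAverage_sub_le h0 ht (hu.integrableOn_ball hβ z r) c
  calc meanOsc μ u z r ≤ ⨍⁻ y in ball z r, (‖u y - c‖ₑ + ‖a - c‖ₑ) ∂μ := by
        refine setLAverage_mono_on measurableSet_ball fun y _ => ?_
        rw [← ha, show u y - a = (u y - c) - (a - c) by ring]
        exact enorm_sub_le
    _ = (⨍⁻ y in ball z r, ‖u y - c‖ₑ ∂μ) + ‖a - c‖ₑ := by
        rw [setLAverage_eq, lintegral_add_left (hm.sub_const c).enorm, setLIntegral_const,
          ENNReal.add_div, ENNReal.mul_div_cancel_right h0 ht, ← setLAverage_eq]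
    _ ≤ _ := by rw [two_mul]; gcongr

/-- A qualitative bound: it supplies the finiteness required for absorbing terms and for pulling
constants out of integrals. -/
theorem oscMaximal_le_of_holderWith (hβ : 0 < β) {u : X → ℝ} {C : ℝ≥0} (hu : HolderWith C β u) (x : X) :
    oscMaximal μ β u x ≤ 2 * C := by
  refine ballSup_le fun z r hr _ => ?_
  rw [ENNReal.div_le_iff (ofReal_rpow_ne_zero hr) (ofReal_rpow_ne_top β.coe_nonneg), mul_assoc]
  refine (meanOsc_le_two_mul hβ ⟨C, hu⟩ hr (u z)).trans ?_
  gcongr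
  exact setLAverage_le_of_forall_le measurableSet_ball (measure_ball_ne_zero μ hr)
    (measure_ball_ne_top μ) fun y hy => hu.enorm_sub_le_of_mem_ball hy

theorem edist_average_le_mul_meanOsc (hβ : 0 < β) (hu : MemHolder β u) {x z : X} {r ρ : ℝ}
    (hr : 0 < r) (hsub : ball z r ⊆ ball x ρ) {C : ℝ≥0∞}
    (hC : μ (ball x ρ) ≤ C * μ (ball z r)) :
    edist (⨍ w in ball z r, u w ∂μ) (⨍ w in ball x ρ, u w ∂μ) ≤ C * meanOsc μ u x ρ := by
  have h0 := measure_ball_ne_zero μ (x := z) hr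
  have ht := measure_ball_ne_top μ (x := z) (r := r)
  rw [edist_eq_enorm_sub]
  exact (enorm_setAverage_sub_le h0 ht (hu.integrableOn_ball hβ z r) _).trans
    (setLAverage_le_mul_of_subset hsub h0 (measure_ball_ne_top μ) hC _)

/-- Telescoping over the balls B(x, 2r·2^{-i}), the first of which contains B(z, r). As u is
continuous, the averages converge to u(x) at every x, so no null set has to be discarded. -/
theorem enorm_sub_average_le_tsum {s : ℕ}
    (hs : ∀ (x : X) (r : ℝ), 0 < r → μ (ball x (2 * r)) ≤ 2 ^ s * μ (ball x r))
    (hβ : 0 < β) (hu : MemHolder β u) {x z : X} {r : ℝ} (hx : x ∈ ball z r) :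
    ‖u x - ⨍ w in ball z r, u w ∂μ‖ₑ ≤
      2 ^ (2 * s + 1) * ∑' i : ℕ, meanOsc μ u x (2 * r * (1 / 2) ^ i) := by
  have hr : 0 < r := pos_of_mem_ball hx
  set ρ : ℕ → ℝ := fun i => 2 * r * (1 / 2) ^ i with hρ
  have hρ0 : ∀ i, 0 < ρ i := fun i => by simp only [hρ]; positivity
  set A : ℕ → ℝ := fun i => ⨍ w in ball x (ρ i), u w ∂μ with hA
  have hlim : Filter.Tendsto A Filter.atTop (nhds (u x)) := by
    have hu' := hu
    obtain ⟨C, hC⟩ := hu'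
    rw [tendsto_iff_edist_tendsto_0]
    have hbound : ∀ i, edist (A i) (u x) ≤ C * ENNReal.ofReal (ρ i) ^ (β : ℝ) := fun i => by
      rw [edist_eq_enorm_sub]
      refine (enorm_setAverage_sub_le (measure_ball_ne_zero μ (hρ0 i)) (measure_ball_ne_top μ)
        (hu.integrableOn_ball hβ x _) _).trans ?_
      exact setLAverage_le_of_forall_le measurableSet_ball (measure_ball_ne_zero μ (hρ0 i))
        (measure_ball_ne_top μ) fun y hy => hC.enorm_sub_le_of_mem_ball hy
    have hρlim : Filter.Tendsto ρ Filter.atTop (nhds 0) := by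
      have := (tendsto_pow_atTop_nhds_zero_of_lt_one (r := (1 / 2 : ℝ)) (by norm_num)
        (by norm_num)).const_mul (2 * r)
      simpa [hρ] using this
    have hc : Continuous fun t : ℝ => (C : ℝ≥0∞) * ENNReal.ofReal t ^ (β : ℝ) :=
      (ENNReal.continuous_const_mul ENNReal.coe_ne_top).comp
        (ENNReal.continuous_rpow_const.comp ENNReal.continuous_ofReal)
    have h0 := (hc.tendsto 0).comp hρlim
    have hβ' : 0 < (β : ℝ) := hβ
    simp only [ENNReal.ofReal_zero, ENNReal.zero_rpow_of_pos hβ', mul_zero] at h0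
    exact tendsto_of_tendsto_of_tendsto_of_le_of_le tendsto_const_nhds h0 (fun _ => zero_le) hbound
  have hstep : ∀ i, edist (A i) (A i.succ) ≤ 2 ^ s * meanOsc μ u x (ρ i) := fun i => by
    rw [edist_comm]
    have h2 : ρ i = 2 * ρ i.succ := by simp only [hρ, Nat.succ_eq_add_one]; ring
    refine edist_average_le_mul_meanOsc hβ hu (hρ0 _) (ball_subset_ball ?_) ?_
    · linarith [hρ0 i.succ]
    · rw [h2]
      exact hs x _ (hρ0 _)
  have h1 := edist_le_tsum_of_edist_le_of_tendsto₀ _ hstep hlim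
  have h2 : edist (⨍ w in ball z r, u w ∂μ) (A 0) ≤ 2 ^ (s * 2) * meanOsc μ u x (ρ 0) := by
    have hρ00 : ρ 0 = 2 * r := by simp [hρ]
    have hd := mem_ball.1 hx
    refine edist_average_le_mul_meanOsc hβ hu hr (ball_subset_ball' ?_) ?_
    · rw [hρ00, dist_comm]; linarith
    · refine le_trans (measure_mono (ball_subset_ball' ?_)) (measure_ball_two_pow_le hs 2 hr)
      rw [hρ00]; linarith
  rw [← edist_eq_enorm_sub, edist_comm]
  calc _ ≤ edist (⨍ w in ball z r, u w ∂μ) (A 0) + edist (A 0) (u x) := edist_triangle _ _ _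
    _ ≤ 2 ^ (s * 2) * ∑' i, meanOsc μ u x (ρ i) + 2 ^ (s * 2) * ∑' i, meanOsc μ u x (ρ i) := by
        refine add_le_add (h2.trans ?_) (h1.trans ?_)
        · gcongr
          exact ENNReal.le_tsum 0
        · rw [ENNReal.tsum_mul_left]
          gcongr
          · norm_num
          · omega
    _ = _ := by ring

theorem ofReal_mul_half_pow_rpow {r : ℝ} (hr : 0 ≤ r) (i : ℕ) {a : ℝ} (ha : 0 ≤ a) :
    ENNReal.ofReal (r * (1 / 2) ^ i) ^ a = ENNReal.ofReal r ^ a * ((2⁻¹ : ℝ≥0∞) ^ a) ^ i := by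
  rw [ENNReal.ofReal_mul hr, ENNReal.mul_rpow_of_nonneg _ _ ha, ENNReal.ofReal_pow (by norm_num),
    ← ENNReal.rpow_natCast, ← ENNReal.rpow_natCast, ← ENNReal.rpow_mul, ← ENNReal.rpow_mul, mul_comm a]
  congr 3
  rw [one_div, ENNReal.ofReal_inv_of_pos (by norm_num)]
  norm_num

theorem tsum_half_rpow_pow_ne_top {a : ℝ} (ha : 0 < a) :
    ∑' i : ℕ, ((2⁻¹ : ℝ≥0∞) ^ a) ^ i ≠ ∞ := by
  rw [ENNReal.tsum_geometric, ENNReal.inv_ne_top, Ne, tsub_eq_zero_iff_le, not_le]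
  exact ENNReal.rpow_lt_one (by simp) ha

theorem exists_enorm_sub_average_le (μ : Measure X) [IsDoublingSpace μ] (hβ : 0 < β) :
    ∃ C : ℝ≥0, ∀ u : X → ℝ, MemHolder β u → ∀ (x z : X) (r : ℝ), x ∈ ball z r →
      ‖u x - ⨍ w in ball z r, u w ∂μ‖ₑ ≤
        C * ENNReal.ofReal r ^ (β : ℝ) * oscMaximal μ β u x := by
  obtain ⟨s, -, hs⟩ := exists_doubling_exponent μ
  set K : ℝ≥0∞ := 2 ^ (2 * s + 1) * (2 ^ (β : ℝ) * ∑' i : ℕ, ((2⁻¹ : ℝ≥0∞) ^ (β : ℝ)) ^ i) with hK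
  have hKt : K ≠ ∞ := ENNReal.mul_ne_top (ENNReal.pow_ne_top ENNReal.ofNat_ne_top) (ENNReal.mul_ne_top
    (ENNReal.rpow_ne_top_of_nonneg β.coe_nonneg ENNReal.ofNat_ne_top) (tsum_half_rpow_pow_ne_top hβ))
  refine ⟨K.toNNReal, fun u hu x z r hx => ?_⟩
  rw [ENNReal.coe_toNNReal hKt]
  have hr : 0 < r := pos_of_mem_ball hx
  refine (enorm_sub_average_le_tsum hs hβ hu hx).trans ?_
  calc 2 ^ (2 * s + 1) * ∑' i : ℕ, meanOsc μ u x (2 * r * (1 / 2) ^ i)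
      ≤ 2 ^ (2 * s + 1) * ∑' i : ℕ, (ENNReal.ofReal (2 * r) ^ (β : ℝ) *
          ((2⁻¹ : ℝ≥0∞) ^ (β : ℝ)) ^ i) * oscMaximal μ β u x := by
        gcongr with i
        rw [← ofReal_mul_half_pow_rpow (by positivity) i β.coe_nonneg]
        have : 0 < 2 * r * (1 / 2) ^ i := by positivity
        exact meanOsc_le_oscMaximal this (mem_ball_self this)
    _ = _ := by
        rw [ENNReal.tsum_mul_right, ENNReal.tsum_mul_left, hK,
          ENNReal.ofReal_mul (by norm_num), ENNReal.mul_rpow_of_nonneg _ _ β.coe_nonneg,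
          ENNReal.ofReal_ofNat]
        ring

/-- Both points lie in B(x, 2d(x, y)), whose average is compared with u(x) and u(y). Thus a multiple
of the sharp maximal function is a Hajłasz gradient, with empty exceptional set. -/
theorem exists_edist_le_oscMaximal (μ : Measure X) [IsDoublingSpace μ] (hβ : 0 < β) :
    ∃ C : ℝ≥0, ∀ u : X → ℝ, MemHolder β u → ∀ x y : X,
      edist (u x) (u y) ≤
        C * edist x y ^ (β : ℝ) * (oscMaximal μ β u x + oscMaximal μ β u y) := by
  obtain ⟨C, hC⟩ := exists_enorm_sub_average_le μ hβ
  refine ⟨C * 2 ^ (β : ℝ), fun u hu x y => ?_⟩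
  rcases eq_or_ne x y with rfl | hxy
  · simp
  have hd : 0 < dist x y := dist_pos.2 hxy
  have hx : x ∈ ball x (2 * dist x y) := mem_ball_self (by positivity)
  have hy : y ∈ ball x (2 * dist x y) := by rw [mem_ball, dist_comm]; linarith
  have hrd : ENNReal.ofReal (2 * dist x y) ^ (β : ℝ) = 2 ^ (β : ℝ) * edist x y ^ (β : ℝ) := by
    rw [ENNReal.ofReal_mul (by norm_num), ENNReal.mul_rpow_of_nonneg _ _ β.coe_nonneg,
      ENNReal.ofReal_ofNat, edist_dist]
  calc edist (u x) (u y) ≤ edist (u x) (⨍ w in ball x (2 * dist x y), u w ∂μ) +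
        edist (⨍ w in ball x (2 * dist x y), u w ∂μ) (u y) := edist_triangle _ _ _
    _ ≤ C * ENNReal.ofReal (2 * dist x y) ^ (β : ℝ) * oscMaximal μ β u x +
        C * ENNReal.ofReal (2 * dist x y) ^ (β : ℝ) * oscMaximal μ β u y := by
        gcongr
        · rw [edist_eq_enorm_sub]; exact hC u hu x _ _ hx
        · rw [edist_comm, edist_eq_enorm_sub]; exact hC u hu y _ _ hy
    _ = _ := by
        rw [hrd, ENNReal.coe_mul, ENNReal.coe_rpow_of_nonneg _ β.coe_nonneg, ENNReal.coe_ofNat]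
        ring

/-- McShane's extension theorem for Hölder functions. -/
theorem HolderOnWith.extend_real {X : Type*} [MetricSpace X] {β : ℝ≥0} (hβ : 0 < β) (hβ1 : β ≤ 1)
    {u : X → ℝ} {C : ℝ≥0} {s : Set X} (hu : HolderOnWith C β u s) :
    ∃ v : X → ℝ, HolderWith C β v ∧ ∀ x ∈ s, v x = u x := by
  let e : Snowflaking X (β : ℝ) (NNReal.coe_pos.2 hβ) (NNReal.coe_le_one.2 hβ1) ≃ X :=
    Snowflaking.ofSnowflaking
  have h : LipschitzOnWith C (u ∘ e) (e ⁻¹' s) := fun x hx y hy => by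
    rw [Snowflaking.edist_def]
    exact hu _ hx _ hy
  obtain ⟨g, hg, hgs⟩ := h.extend_real
  refine ⟨g ∘ e.symm, fun x y => ?_, fun x hx => ?_⟩
  · have := hg (e.symm x) (e.symm y)
    rw [Snowflaking.edist_def] at this
    simpa [e] using this
  · have := hgs (x := e.symm x) (by simpa using hx)
    simpa using this.symm

/-- On the set where the maximal function is at most t, the pointwise estimate says that u is Hölder
with constant comparable to t, so McShane's extension applies. -/
theorem exists_holderWith_eq_off_superlevel (μ : Measure X) [IsDoublingSpace μ] (hβ : 0 < β)
    (hβ1 : β ≤ 1) :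
    ∃ C : ℝ≥0, ∀ u : X → ℝ, MemHolder β u → ∀ t : ℝ≥0, ∃ v : X → ℝ, HolderWith (C * t) β v ∧
      ∀ x, ¬ (t : ℝ≥0∞) < oscMaximal μ β u x → v x = u x := by
  obtain ⟨C, hC⟩ := exists_edist_le_oscMaximal μ hβ
  refine ⟨C * 2, fun u hu t => ?_⟩
  refine HolderOnWith.extend_real hβ hβ1 (s := {x | ¬ (t : ℝ≥0∞) < oscMaximal μ β u x})
    fun x hx y hy => (hC u hu x y).trans ?_
  calc _ ≤ C * edist x y ^ (β : ℝ) * ((t : ℝ≥0∞) + t) := by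
        gcongr
        · exact not_lt.1 hx
        · exact not_lt.1 hy
    _ = _ := by push_cast; ring

end Oscillation

/-! ### Sums of geometric type. -/

section GeometricSums

/-- For geometrically growing terms any selected subsum is controlled by its last selected term:
drop the unselected tail, then fill in all smaller indices. -/
theorem sum_ite_le_mul {v : ℕ → ℝ≥0∞} {C Y : ℝ≥0∞}
    (hv : ∀ n, ∑ i ∈ Finset.range (n + 1), v i ≤ C * v n) (P : ℕ → Prop) [DecidablePred P] (n : ℕ)
    (hP : ∀ i < n, P i → v i ≤ Y) :
    ∑ i ∈ Finset.range n, (if P i then v i else 0) ≤ C * Y := by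
  induction n with
  | zero => simp
  | succ n ih =>
    by_cases h : P n
    · calc ∑ i ∈ Finset.range (n + 1), (if P i then v i else 0)
          ≤ ∑ i ∈ Finset.range (n + 1), v i := by
            gcongr with i
            split_ifs <;> simp
        _ ≤ C * v n := hv n
        _ ≤ C * Y := by gcongr; exact hP n (Nat.lt_succ_self n) h
    · rw [Finset.sum_range_succ, if_neg h, add_zero]
      exact ih fun i hi => hP i (hi.trans (Nat.lt_succ_self n))

theorem sum_range_succ_mul_pow_le {x : ℝ≥0∞} (hx : 1 < x) (hx' : x ≠ ∞) (c : ℝ≥0∞) (n : ℕ) :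
    ∑ i ∈ Finset.range (n + 1), c * x ^ i ≤ (1 - x⁻¹)⁻¹ * (c * x ^ n) := by
  have hx0 : x ≠ 0 := (zero_lt_one.trans hx).ne'
  have h1 : 1 ≤ (1 - x⁻¹)⁻¹ := ENNReal.one_le_inv.2 tsub_le_self
  have hK : 1 + x⁻¹ * (1 - x⁻¹)⁻¹ = (1 - x⁻¹)⁻¹ := by
    rw [← ENNReal.tsum_geometric, ← ENNReal.tsum_mul_left]
    nth_rewrite 2 [tsum_eq_zero_add' ENNReal.summable]
    simp only [pow_succ', pow_zero]
  induction n with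
  | zero => simpa using le_mul_of_one_le_left' h1
  | succ n ih =>
    rw [Finset.sum_range_succ]
    calc _ ≤ (1 - x⁻¹)⁻¹ * (c * x ^ n) + c * x ^ (n + 1) := by gcongr
      _ = (1 + x⁻¹ * (1 - x⁻¹)⁻¹) * (c * x ^ (n + 1)) := by
        have : x⁻¹ * (1 - x⁻¹)⁻¹ * (c * x ^ (n + 1)) = x⁻¹ * x * ((1 - x⁻¹)⁻¹ * (c * x ^ n)) := by
          ring
        rw [add_mul, this, ENNReal.inv_mul_cancel hx0 hx']
        ring
      _ = _ := by rw [hK]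

/-- The selected sum is at most twice a bound for its terms, and one such bound is the ℓ^p-norm. The
constant is independent of n, whereas Hölder's inequality would lose n^{p-1} and cancel the gain
from averaging. -/
theorem rpow_sum_ite_two_pow_le {p : ℝ} (hp : 0 < p) (c : ℝ≥0∞) (P : ℕ → Prop) [DecidablePred P]
    (n : ℕ) :
    (∑ i ∈ Finset.range n, (if P i then c * 2 ^ i else 0)) ^ p ≤
      2 ^ p * ∑ i ∈ Finset.range n, (if P i then (c * 2 ^ i) ^ p else 0) := by
  have h2 : ((1 : ℝ≥0∞) - 2⁻¹)⁻¹ = 2 := by rw [ENNReal.one_sub_inv_two, inv_inv]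
  have h := sum_ite_le_mul (v := fun i => c * 2 ^ i) (C := 2)
    (Y := (∑ i ∈ Finset.range n, (if P i then (c * 2 ^ i) ^ p else 0)) ^ (1 / p))
    (fun n => by
      have := sum_range_succ_mul_pow_le (x := 2) (by norm_num) (by norm_num) c n
      rwa [h2] at this) P n (fun i hi hPi => by
      rw [one_div, ENNReal.le_rpow_inv_iff hp]
      calc (c * 2 ^ i) ^ p = if P i then (c * 2 ^ i) ^ p else 0 := (if_pos hPi).symm
        _ ≤ _ := Finset.single_le_sum (f := fun i => if P i then (c * 2 ^ i) ^ p else 0)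
          (fun _ _ => zero_le) (Finset.mem_range.2 hi))
  calc _ ≤ (2 * (∑ i ∈ Finset.range n, (if P i then (c * 2 ^ i) ^ p else 0)) ^ (1 / p)) ^ p := by
        gcongr
    _ = _ := by
        rw [ENNReal.mul_rpow_of_nonneg _ _ hp.le, ← ENNReal.rpow_mul, one_div_mul_cancel hp.ne',
          ENNReal.rpow_one]

/-- This choice of the number k of averaged levels is where p > 1 enters the absorption. -/
theorem exists_nat_mul_inv_rpow_mul_le {p : ℝ} (hp : 1 < p) (C : ℝ≥0) :
    ∃ k : ℕ, 0 < k ∧ C * ((k : ℝ≥0∞)⁻¹ ^ p * k) ≤ 2⁻¹ := by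
  have hlim : Filter.Tendsto (fun k : ℕ => (C : ℝ≥0∞) * (k : ℝ≥0∞)⁻¹ ^ (p - 1)) Filter.atTop
      (nhds 0) := by
    have h1 := (ENNReal.continuous_rpow_const (y := p - 1)).tendsto 0 |>.comp
      ENNReal.tendsto_inv_nat_nhds_zero
    rw [ENNReal.zero_rpow_of_pos (by linarith)] at h1
    have h2 := ENNReal.Tendsto.const_mul (a := (C : ℝ≥0∞)) h1 (Or.inr ENNReal.coe_ne_top)
    rwa [mul_zero] at h2
  obtain ⟨k, hk, hk0⟩ := ((hlim.eventually (gt_mem_nhds (by simp : (0 : ℝ≥0∞) < 2⁻¹))).and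
    (Filter.eventually_gt_atTop 0)).exists
  refine ⟨k, hk0, le_trans (le_of_eq ?_) hk.le⟩
  have hk1 : (k : ℝ≥0∞)⁻¹ ≠ 0 := by simp
  have hk2 : (k : ℝ≥0∞)⁻¹ ≠ ∞ := ENNReal.inv_ne_top.2 (by positivity)
  rw [ENNReal.rpow_sub _ _ hk1 hk2, ENNReal.rpow_one, div_eq_mul_inv, inv_inv]

end GeometricSums

/-! ### Distance between a function and its Hölder extension. -/

section Whitney

variable {X : Type*} [MetricSpace X] [MeasurableSpace X] [BorelSpace X] {β : ℝ≥0}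

/-- If `v` is a Hölder extension of the restriction of `u` to the complement of a superlevel set
of the sharp maximal function, then the mean of `|u - v|` over a ball is controlled by the part
of the superlevel set in a larger ball. -/
theorem exists_setLIntegral_sub_extension_le (μ : Measure X) [IsDoublingSpace μ] (hβ : 0 < β)
    (C₀ : ℝ≥0) :
    ∃ C : ℝ≥0, ∀ u : X → ℝ, MemHolder β u → ∀ (t : ℝ≥0) (v : X → ℝ), HolderWith (C₀ * t) β v →
      (∀ x, ¬ (t : ℝ≥0∞) < oscMaximal μ β u x → v x = u x) →
      ∀ (z : X) (r : ℝ), ∀ y₀ ∈ ball z r, ¬ (t : ℝ≥0∞) < oscMaximal μ β u y₀ →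
        ∫⁻ y in ball z r, ‖u y - v y‖ₑ ∂μ ≤ C * ENNReal.ofReal r ^ (β : ℝ) *
          (t * μ ({x | (t : ℝ≥0∞) < oscMaximal μ β u x} ∩ ball z (3 * r))) := by
  obtain ⟨C₁, hC₁⟩ := exists_enorm_sub_average_le μ hβ
  obtain ⟨C₂, hC₂⟩ := exists_measure_ball_mul_le μ 10
  refine ⟨C₂ * ((1 + C₁ + C₀) * 6 ^ (β : ℝ)), fun u hu t v hv hvu z r y₀ hy₀ hy₀t => ?_⟩
  set U := {x | (t : ℝ≥0∞) < oscMaximal μ β u x} with hU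
  have hUo : IsOpen U := isOpen_lt_ballSup _ _
  set w : X → ℝ≥0∞ := fun y => ‖u y - v y‖ₑ with hw
  have hw0 : ∀ y ∉ U, w y = 0 := fun y hy => by simp [hw, hvu y hy]
  set K : ℝ≥0∞ := (C₂ * ((1 + C₁ + C₀) * 6 ^ (β : ℝ)) : ℝ≥0) * ENNReal.ofReal r ^ (β : ℝ) * t with hK
  have hr : 0 < r := pos_of_mem_ball hy₀
  -- The covering balls are B(x, d/5), with d the distance from x to the complement of U. They lie
  -- in U, and their fivefold enlargements B(x, d) come within distance 2d of a point y where v = u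
  -- and the maximal function is at most t.
  have hcov : ∫⁻ y in ball z r ∩ U, w y ∂μ ≤ ∫⁻ y, (U ∩ ball z (3 * r)).indicator (fun _ => K) y ∂μ := by
    refine lintegral_le_of_ball_covering μ fun x hx => ?_
    have hne : (Uᶜ).Nonempty := ⟨y₀, hy₀t⟩
    set d := infDist x Uᶜ with hd
    have hd0 : 0 < d := (hUo.isClosed_compl.notMem_iff_infDist_pos hne).1 (fun h => h hx.2)
    -- The point y₀ outside U prevents d from exceeding the scale of the ball; later 3d ≤ 6r gives
    -- the factor 6^β.
    have hdr : d < 2 * r := by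
      have h1 : d ≤ dist x y₀ := infDist_le_dist_of_mem hy₀t
      have h2 := dist_triangle_right x y₀ z
      have h3 := mem_ball.1 hx.1
      have h4 := mem_ball.1 hy₀
      linarith
    have hdU : ball x d ⊆ U := ball_infDist_compl_subset
    obtain ⟨y, hyU, hxy⟩ := (infDist_lt_iff hne).1 (by linarith : infDist x Uᶜ < 2 * d)
    have hyt : oscMaximal μ β u y ≤ t := not_lt.1 hyU
    have hyB : y ∈ ball x (2 * d) := by rwa [mem_ball, dist_comm]
    refine ⟨x, d / 5, by positivity, mem_ball_self (by positivity), ?_⟩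
    rw [show 5 * (d / 5) = d by ring]
    set a := ⨍ b in ball x (2 * d), u b ∂μ with ha
    set c : ℝ≥0∞ := ENNReal.ofReal (3 * d) ^ (β : ℝ) * t with hc
    have h23 : ENNReal.ofReal (2 * d) ^ (β : ℝ) ≤ ENNReal.ofReal (3 * d) ^ (β : ℝ) := by
      gcongr; norm_num
    have hya : ‖u y - a‖ₑ ≤ C₁ * c := by
      refine (hC₁ u hu y x _ hyB).trans ?_
      rw [hc, mul_assoc]
      gcongr
    -- The values u(b) and v(b) are compared through the average a of u over B(x, 2d) and the common
    -- value u(y) = v(y).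
    have hpt : ∀ b ∈ ball x d, w b ≤ ‖u b - a‖ₑ + (C₁ + C₀) * c := fun b hb => by
      have hvb : ‖v b - v y‖ₑ ≤ C₀ * c := by
        have hby : b ∈ ball y (3 * d) := by
          have h1 := dist_triangle b x y
          have h2 := mem_ball.1 hb
          rw [mem_ball]; linarith
        refine (hv.enorm_sub_le_of_mem_ball hby).trans (le_of_eq ?_)
        rw [hc]; push_cast; ring
      have hyv : v y = u y := hvu y hyU
      calc w b = ‖(u b - a) - ((u y - a) + (v b - v y))‖ₑ := by
            simp only [hw]; rw [hyv]; congr 1; ring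
        _ ≤ ‖u b - a‖ₑ + (‖u y - a‖ₑ + ‖v b - v y‖ₑ) :=
            enorm_sub_le.trans (by gcongr; exact enorm_add_le _ _)
        _ ≤ ‖u b - a‖ₑ + (C₁ * c + C₀ * c) := by gcongr
        _ = _ := by ring
    have hB0 := measure_ball_ne_zero μ (x := x) (r := 2 * d) (by positivity)
    have hBt := measure_ball_ne_top μ (x := x) (r := 2 * d)
    have hosc : ∫⁻ b in ball x (2 * d), ‖u b - a‖ₑ ∂μ ≤ c * μ (ball x (2 * d)) := by
      rw [← ENNReal.div_le_iff hB0 hBt, ← setLAverage_eq]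
      refine (meanOsc_le_oscMaximal (β := β) (by positivity) hyB).trans ?_
      rw [hc]
      gcongr
    calc ∫⁻ b in ball x d, w b ∂μ
        ≤ ∫⁻ b in ball x d, (‖u b - a‖ₑ + (C₁ + C₀) * c) ∂μ :=
          setLIntegral_mono' measurableSet_ball hpt
      _ ≤ ∫⁻ b in ball x (2 * d), (‖u b - a‖ₑ + (C₁ + C₀) * c) ∂μ :=
          lintegral_mono_set (ball_subset_ball (by linarith))
      _ = ∫⁻ b in ball x (2 * d), ‖u b - a‖ₑ ∂μ + (C₁ + C₀) * c * μ (ball x (2 * d)) := by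
          rw [lintegral_add_right _ measurable_const, setLIntegral_const]
      _ ≤ c * μ (ball x (2 * d)) + (C₁ + C₀) * c * μ (ball x (2 * d)) := by gcongr
      _ = (1 + C₁ + C₀) * c * μ (ball x (10 * (d / 5))) := by
          rw [show 10 * (d / 5) = 2 * d by ring]; ring
      _ ≤ (1 + C₁ + C₀) * c * (C₂ * μ (ball x (d / 5))) := by
          gcongr; exact hC₂ x _ (by positivity)
      _ ≤ (1 + C₁ + C₀) * (6 ^ (β : ℝ) * ENNReal.ofReal r ^ (β : ℝ) * t) *
            (C₂ * μ (ball x (d / 5))) := by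
          rw [hc]
          gcongr
          rw [← ENNReal.ofReal_ofNat 6, ← ENNReal.mul_rpow_of_nonneg _ _ β.coe_nonneg,
            ← ENNReal.ofReal_mul (by norm_num)]
          exact ENNReal.rpow_le_rpow (ENNReal.ofReal_le_ofReal (by linarith)) β.coe_nonneg
      _ = ∫⁻ _ in ball x (d / 5), K ∂μ := by
          rw [setLIntegral_const, hK]
          push_cast [ENNReal.coe_rpow_of_nonneg _ β.coe_nonneg]
          ring
      _ = ∫⁻ b in ball x (d / 5), (U ∩ ball z (3 * r)).indicator (fun _ => K) b ∂μ := by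
          refine setLIntegral_congr_fun measurableSet_ball fun b hb => ?_
          rw [indicator_of_mem]
          refine ⟨hdU (ball_subset_ball (by linarith) hb), ?_⟩
          have h1 := dist_triangle b x z
          have h2 := mem_ball.1 hb
          have h3 := mem_ball.1 hx.1
          rw [mem_ball]; linarith
  calc ∫⁻ y in ball z r, w y ∂μ = ∫⁻ y in ball z r, U.indicator w y ∂μ := by
        congr 1
        exact (indicator_eq_self.2 fun y hy => by
          by_contra h
          exact hy (hw0 y h)).symm
    _ = ∫⁻ y in ball z r ∩ U, w y ∂μ := by
        rw [lintegral_indicator hUo.measurableSet, Measure.restrict_restrict hUo.measurableSet,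
          inter_comm]
    _ ≤ _ := hcov
    _ = _ := by
        rw [lintegral_indicator_const (hUo.inter isOpen_ball).measurableSet, hK]
        ring

end Whitney

/-! ### Finite sums in a 𝒟-structure. -/

namespace DStructure

variable {X : Type*} [MetricSpace X] [MeasurableSpace X] {μ : Measure X} {p : ℝ} {β : ℝ≥0}

/-- The convention 0·∞ = 0 turns any element of 𝒟(0) into the zero function. -/
theorem zero_mem (D : DStructure μ p β) : (0 : X → ℝ≥0∞) ∈ D.toFun 0 := by
  obtain ⟨g, hg⟩ := D.nonempty 0 memHolder_zero
  have := D.smul_mem 0 memHolder_zero 0 g hg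
  simp only [enorm_zero, zero_mul, smul_zero] at this
  exact this

theorem memHolder_sum {X : Type*} [MetricSpace X] {β : ℝ≥0} (v : ℕ → X → ℝ) (hv : ∀ j, MemHolder β (v j)) (n : ℕ) :
    MemHolder β (∑ j ∈ Finset.range n, v j) := by
  induction n with
  | zero => exact memHolder_zero
  | succ n ih => rw [Finset.sum_range_succ]; exact ih.add (hv n)

theorem sum_mem (D : DStructure μ p β) (v : ℕ → X → ℝ) (g : ℕ → X → ℝ≥0∞)
    (hv : ∀ j, MemHolder β (v j)) (hg : ∀ j, g j ∈ D.toFun (v j)) (n : ℕ) :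
    ∑ j ∈ Finset.range n, g j ∈ D.toFun (∑ j ∈ Finset.range n, v j) := by
  induction n with
  | zero => exact D.zero_mem
  | succ n ih =>
    rw [Finset.sum_range_succ, Finset.sum_range_succ]
    exact D.add_mem _ _ (memHolder_sum v hv n) (hv n) _ ih _ (hg n)

end DStructure

/-! ### The oscillation estimate on a single ball. -/

section LocalEstimate

variable {X : Type*} [MetricSpace X] [MeasurableSpace X] [BorelSpace X] {p : ℝ} {β : ℝ≥0}

/-- A ball of large oscillation forces every larger concentric ball of comparable radius to
oscillate, so the maximal function is bounded below on all of B(z, σr). This lower bound later gives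
the bounded overlap in l of the sets carrying g. -/
theorem exists_lt_two_pow_mul_oscMaximal (μ : Measure X) [IsDoublingSpace μ] (hβ : 0 < β) (σ : ℝ)
    (hσ : 1 ≤ σ) :
    ∃ m : ℕ, ∀ u : X → ℝ, MemHolder β u → ∀ (l : ℝ≥0) (z : X) (r : ℝ), 0 < r →
      ENNReal.ofReal r ^ (β : ℝ) * l < meanOsc μ u z r → ∀ x ∈ ball z (σ * r),
        (l : ℝ≥0∞) < 2 ^ m * oscMaximal μ β u x := by
  obtain ⟨C, hC⟩ := exists_measure_ball_mul_le μ σ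
  obtain ⟨m, hm⟩ := pow_unbounded_of_one_lt (2 * C * σ.toNNReal ^ (β : ℝ)) (one_lt_two (α := ℝ≥0))
  refine ⟨m, fun u hu l z r hr hl x hx => ?_⟩
  have hσ0 : 0 < σ := by linarith
  have h : meanOsc μ u z r ≤ 2 * (C * (ENNReal.ofReal (σ * r) ^ (β : ℝ) * oscMaximal μ β u x)) := by
    refine (meanOsc_le_two_mul hβ hu hr (⨍ w in ball z (σ * r), u w ∂μ)).trans ?_
    gcongr
    refine (setLAverage_le_mul_of_subset (ball_subset_ball ?_) (measure_ball_ne_zero μ hr)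
      (measure_ball_ne_top μ) (hC z r hr) _).trans ?_
    · nlinarith
    · gcongr
      exact meanOsc_le_oscMaximal (by positivity) hx
  have h2 : ENNReal.ofReal r ^ (β : ℝ) * l <
      ENNReal.ofReal r ^ (β : ℝ) * (2 ^ m * oscMaximal μ β u x) := by
    refine (hl.trans_le h).trans_le ?_
    rw [ENNReal.ofReal_mul hσ0.le, ENNReal.mul_rpow_of_nonneg _ _ β.coe_nonneg]
    calc _ = ENNReal.ofReal r ^ (β : ℝ) *
          ((2 * C * σ.toNNReal ^ (β : ℝ) : ℝ≥0) * oscMaximal μ β u x) := by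
          push_cast [ENNReal.coe_rpow_of_nonneg _ β.coe_nonneg]
          rw [ENNReal.ofReal]
          ring
      _ ≤ _ := by
          gcongr
          exact_mod_cast hm.le
  exact lt_of_mul_lt_mul_left' h2

/-- The integrand controlling the superlevel set `{l < f}` in terms of the higher superlevel sets
of `f` and of the function `g` on a set where `f` is comparable to `l`. -/
noncomputable def levelIntegrand {X : Type*} (p : ℝ) (k m : ℕ) (l : ℝ≥0) (f g : X → ℝ≥0∞) (x : X) : ℝ≥0∞ :=
  (k : ℝ≥0∞)⁻¹ ^ p * ∑ j ∈ Finset.range k,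
      {x | 2 ^ k * (l : ℝ≥0∞) * 2 ^ j < f x}.indicator (fun _ => (2 ^ k * (l : ℝ≥0∞) * 2 ^ j) ^ p) x +
    {x | (l : ℝ≥0∞) < 2 ^ m * f x ∧ f x ≤ 2 ^ (2 * k) * (l : ℝ≥0∞)}.indicator (fun x => g x ^ p) x

-- The factor 4^p is 2^p from (a + b)^p ≤ 2^p (a^p + b^p) times 2^p from the geometric sum, whose
-- constant does not depend on k.
open Classical in
theorem rpow_add_indicator_le {X : Type*} {p : ℝ} (hp : 1 ≤ p) {k : ℕ} {l : ℝ≥0} {m : ℕ} {f g : X → ℝ≥0∞} {x : X}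
    (hx : (l : ℝ≥0∞) < 2 ^ m * f x) :
    ((k : ℝ≥0∞)⁻¹ * ∑ j ∈ Finset.range k,
        (if 2 ^ k * (l : ℝ≥0∞) * 2 ^ j < f x then 2 ^ k * (l : ℝ≥0∞) * 2 ^ j else 0) +
      {x | f x ≤ 2 ^ (2 * k) * (l : ℝ≥0∞)}.indicator g x) ^ p ≤
      4 ^ p * levelIntegrand p k m l f g x := by
  have hp0 : 0 < p := by linarith
  have h1 := rpow_sum_ite_two_pow_le hp0 (2 ^ k * (l : ℝ≥0∞))
    (fun j => 2 ^ k * (l : ℝ≥0∞) * 2 ^ j < f x) k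
  set W := ∑ j ∈ Finset.range k,
    (if 2 ^ k * (l : ℝ≥0∞) * 2 ^ j < f x then 2 ^ k * (l : ℝ≥0∞) * 2 ^ j else 0) with hW
  set V := ∑ j ∈ Finset.range k,
    (if 2 ^ k * (l : ℝ≥0∞) * 2 ^ j < f x then (2 ^ k * (l : ℝ≥0∞) * 2 ^ j) ^ p else 0) with hV
  have h2 : (1 : ℝ≥0∞) ≤ 2 ^ p := ENNReal.one_le_rpow (by norm_num) hp0
  have h4 : (2 : ℝ≥0∞) ^ p * 2 ^ p = 4 ^ p := by
    rw [← ENNReal.mul_rpow_of_nonneg _ _ hp0.le]; norm_num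
  have h3 : ({x | f x ≤ 2 ^ (2 * k) * (l : ℝ≥0∞)}.indicator g x) ^ p =
      {x | (l : ℝ≥0∞) < 2 ^ m * f x ∧ f x ≤ 2 ^ (2 * k) * (l : ℝ≥0∞)}.indicator
        (fun x => g x ^ p) x := by
    simp only [indicator_apply, mem_ofPred_eq, hx, true_and]
    split_ifs
    · rfl
    · exact ENNReal.zero_rpow_of_pos hp0
  have h5 : levelIntegrand p k m l f g x = (k : ℝ≥0∞)⁻¹ ^ p * V +
      {x | (l : ℝ≥0∞) < 2 ^ m * f x ∧ f x ≤ 2 ^ (2 * k) * (l : ℝ≥0∞)}.indicator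
        (fun x => g x ^ p) x := by
    simp only [levelIntegrand, hV]
    congr 2
    simp only [indicator_apply, mem_ofPred_eq]
  calc _ ≤ (2 : ℝ≥0∞) ^ p * (((k : ℝ≥0∞)⁻¹ * W) ^ p +
        ({x | f x ≤ 2 ^ (2 * k) * (l : ℝ≥0∞)}.indicator g x) ^ p) := by
        refine (ENNReal.rpow_add_le_mul_rpow_add_rpow _ _ hp).trans ?_
        gcongr
        · norm_num
        · linarith
    _ ≤ (2 : ℝ≥0∞) ^ p * ((k : ℝ≥0∞)⁻¹ ^ p * (2 ^ p * V) + 2 ^ p *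
        {x | (l : ℝ≥0∞) < 2 ^ m * f x ∧ f x ≤ 2 ^ (2 * k) * (l : ℝ≥0∞)}.indicator
        (fun x => g x ^ p) x) := by
        rw [h3, ENNReal.mul_rpow_of_nonneg _ _ hp0.le]
        gcongr
        exact le_mul_of_one_le_left' h2
    _ = _ := by rw [h5, ← h4]; ring

open Classical in
/-- The main local estimate: the oscillation of `u` over a ball is compared with that of an average
of Hölder extensions of `u` from the complements of `k` consecutive superlevel sets. -/
theorem DStructure.exists_meanOsc_le {μ : Measure X} [IsDoublingSpace μ] (D : DStructure μ p β) :
    ∃ (C : ℝ≥0) (σ : ℝ), 1 ≤ σ ∧ ∀ u, MemHolder β u → ∀ g ∈ D.toFun u, ∀ k : ℕ, 0 < k →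
      ∀ (l : ℝ≥0) (z : X) (r : ℝ),
      ∀ y₀ ∈ ball z r, ¬ 2 ^ k * (l : ℝ≥0∞) < oscMaximal μ β u y₀ →
        meanOsc μ u z r ≤ C * ENNReal.ofReal r ^ (β : ℝ) *
          (⨍⁻ x in ball z (σ * r), ((k : ℝ≥0∞)⁻¹ * ∑ j ∈ Finset.range k,
            (if 2 ^ k * (l : ℝ≥0∞) * 2 ^ j < oscMaximal μ β u x
              then 2 ^ k * (l : ℝ≥0∞) * 2 ^ j else 0) +
            {x | oscMaximal μ β u x ≤ 2 ^ (2 * k) * (l : ℝ≥0∞)}.indicator g x) ^ p ∂μ) ^ (1 / p) := by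
  have hβ := D.beta_pos
  have hp := D.one_le_p
  have hp0 := D.p_pos
  obtain ⟨C₁, hC₁⟩ := exists_holderWith_eq_off_superlevel μ hβ D.beta_le_one
  obtain ⟨C₂, hC₂⟩ := exists_setLIntegral_sub_extension_le μ hβ C₁
  obtain ⟨K, τ, hK, hτ, hPoin⟩ := D.poincare
  -- The 3 is the enlargement in the Whitney-type estimate, τ the one in Poincaré's inequality.
  set σ : ℝ := max 3 τ with hσ
  have hσ3 : 3 ≤ σ := le_max_left _ _
  have hστ : τ ≤ σ := le_max_right _ _
  obtain ⟨C₃, hC₃⟩ := exists_measure_ball_mul_le μ σ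
  set K' : ℝ≥0 := (K ^ (1 / p)).toNNReal * 2 ^ (β : ℝ) with hK'
  refine ⟨2 * (C₂ * C₃ + K' * (C₃ ^ (1 / p) * (1 + C₁))), σ, by linarith,
    fun u hu g hg k hk l z r y₀ hy₀ hy₀l => ?_⟩
  have hr : 0 < r := pos_of_mem_ball hy₀
  set f := oscMaximal μ β u with hf
  set t : ℕ → ℝ≥0 := fun j => 2 ^ k * l * 2 ^ j with ht
  have htc : ∀ j, (t j : ℝ≥0∞) = 2 ^ k * (l : ℝ≥0∞) * 2 ^ j := fun j => by simp [ht]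
  choose v hvH hvu using fun j => hC₁ u hu (t j)
  set U : ℕ → Set X := fun j => {x | (t j : ℝ≥0∞) < f x} with hU
  have hUm : ∀ j, MeasurableSet (U j) := fun j => (isOpen_lt_ballSup _ _).measurableSet
  set G : ℕ → X → ℝ≥0∞ := fun j =>
    (U j).indicator (fun _ => ((C₁ * t j : ℝ≥0) : ℝ≥0∞)) + (U j)ᶜ.indicator g with hG
  have hGm : ∀ j, G j ∈ D.toFun (v j) := fun j =>
    D.glue_mem u (v j) hu _ (hvH j) (U j) (hUm j) (fun x hx => hvu j x hx) g hg
  have hvm : ∀ j, MemHolder β (v j) := fun j => ⟨_, hvH j⟩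
  -- Averaging the k extensions makes the singular part of the gradient carry the factor k^{-1}, the
  -- source of the final gain.
  set h : X → ℝ := (k : ℝ)⁻¹ • ∑ j ∈ Finset.range k, v j with hh
  have hhm : MemHolder β h := (DStructure.memHolder_sum v hvm k).smul
  have hgh := D.smul_mem _ (DStructure.memHolder_sum v hvm k) (k : ℝ)⁻¹ _ (D.sum_mem v G hvm hGm k)
  have hk0 : (k : ℝ) ≠ 0 := by positivity
  have hkE : ‖(k : ℝ)⁻¹‖ₑ = (k : ℝ≥0∞)⁻¹ := by
    rw [enorm_inv hk0]; simp
  set κ : ℝ≥0∞ := (k : ℝ≥0∞)⁻¹ with hκ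
  have hκk : κ * k = 1 := ENNReal.inv_mul_cancel (by positivity) (by simp)
  have hκt : κ ≠ ∞ := ENNReal.inv_ne_top.2 (by positivity)
  rw [hkE] at hgh
  set W : X → ℝ≥0∞ := fun x => κ * ∑ j ∈ Finset.range k, (U j).indicator (fun _ => (t j : ℝ≥0∞)) x
    with hW
  have hWm : Measurable W :=
    (Finset.measurable_sum _ fun j _ => measurable_const.indicator (hUm j)).const_mul _
  set F : Set X := {x | f x ≤ 2 ^ (2 * k) * (l : ℝ≥0∞)} with hF
  set Z : X → ℝ≥0∞ := fun x => W x + F.indicator g x with hZ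
  have hZeq : ∀ x, κ * ∑ j ∈ Finset.range k,
      (if 2 ^ k * (l : ℝ≥0∞) * 2 ^ j < f x then 2 ^ k * (l : ℝ≥0∞) * 2 ^ j else 0) +
        F.indicator g x = Z x := fun x => by
    simp only [hZ, hW, indicator_apply, hU, mem_ofPred_eq, htc]
  simp only [hZeq]
  have hB0 := measure_ball_ne_zero μ (x := z) hr
  have hBt := measure_ball_ne_top μ (x := z) (r := r)
  have hσr : 0 < σ * r := by positivity
  set I := ⨍⁻ x in ball z (σ * r), Z x ^ p ∂μ with hI
  -- the difference of `u` and `h`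
  have hdiff : ⨍⁻ y in ball z r, ‖u y - h y‖ₑ ∂μ ≤
      C₂ * ENNReal.ofReal r ^ (β : ℝ) * (C₃ * I ^ (1 / p)) := by
    have hpt : ∀ y, ‖u y - h y‖ₑ ≤ κ * ∑ j ∈ Finset.range k, ‖u y - v j y‖ₑ := fun y => by
      have : u y - h y = (k : ℝ)⁻¹ * ∑ j ∈ Finset.range k, (u y - v j y) := by
        rw [Finset.sum_sub_distrib]
        simp only [hh, Pi.smul_apply, Finset.sum_apply, smul_eq_mul, Finset.sum_const,
          Finset.card_range, nsmul_eq_mul]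
        field_simp
      rw [this, enorm_mul, hkE]
      gcongr
      exact enorm_sum_le _ _
    have hint : ∫⁻ y in ball z r, ‖u y - h y‖ₑ ∂μ ≤
        C₂ * ENNReal.ofReal r ^ (β : ℝ) * ∫⁻ y in ball z (σ * r), W y ∂μ := by
      have hum : Measurable u := (D.continuous_of_memHolder hu).measurable
      calc ∫⁻ y in ball z r, ‖u y - h y‖ₑ ∂μ
          ≤ ∫⁻ y in ball z r, κ * ∑ j ∈ Finset.range k, ‖u y - v j y‖ₑ ∂μ :=
            lintegral_mono hpt
        _ = κ * ∑ j ∈ Finset.range k, ∫⁻ y in ball z r, ‖u y - v j y‖ₑ ∂μ := by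
            rw [lintegral_const_mul' _ _ hκt, lintegral_finsetSum]
            exact fun j _ => (hum.sub (D.continuous_of_memHolder (hvm j)).measurable).enorm
        _ ≤ κ * ∑ j ∈ Finset.range k, C₂ * ENNReal.ofReal r ^ (β : ℝ) *
              (t j * μ (U j ∩ ball z (σ * r))) := by
            gcongr with j
            refine (hC₂ u hu (t j) (v j) (hvH j) (hvu j) z r y₀ hy₀ ?_).trans ?_
            -- The point y₀ lies outside the superlevel set at the lowest level t_0, hence outside
            -- all of them.
            · refine fun hlt => hy₀l (lt_of_le_of_lt ?_ hlt)
              rw [htc]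
              exact le_mul_of_one_le_right' (one_le_pow₀ (by norm_num))
            · gcongr
        _ = _ := by
            rw [← Finset.mul_sum, hW, lintegral_const_mul' _ _ hκt,
              lintegral_finsetSum _ fun j _ => measurable_const.indicator (hUm j)]
            simp only [lintegral_indicator_const (hUm _), Measure.restrict_apply (hUm _)]
            ring
    have hWZ : ⨍⁻ y in ball z (σ * r), W y ∂μ ≤ I ^ (1 / p) := by
      refine (setLAverage_le_rpow_setLAverage (measure_ball_ne_zero μ hσr) (measure_ball_ne_top μ)
        hp hWm.aemeasurable).trans ?_
      rw [hI]
      exact ENNReal.rpow_le_rpow (setLAverage_mono_on measurableSet_ball fun x _ =>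
        ENNReal.rpow_le_rpow le_self_add hp0.le) (by positivity)
    calc ⨍⁻ y in ball z r, ‖u y - h y‖ₑ ∂μ
        ≤ (C₂ * ENNReal.ofReal r ^ (β : ℝ) * ∫⁻ y in ball z (σ * r), W y ∂μ) / μ (ball z r) := by
          rw [setLAverage_eq]; gcongr
      _ ≤ C₂ * ENNReal.ofReal r ^ (β : ℝ) * (C₃ * ⨍⁻ y in ball z (σ * r), W y ∂μ) := by
          rw [mul_div_assoc]
          gcongr
          rw [ENNReal.div_le_iff hB0 hBt]
          calc ∫⁻ y in ball z (σ * r), W y ∂μ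
              = μ (ball z (σ * r)) * ⨍⁻ y in ball z (σ * r), W y ∂μ := by
                rw [setLAverage_eq, ENNReal.mul_div_cancel (measure_ball_ne_zero μ hσr)
                  (measure_ball_ne_top μ)]
            _ ≤ C₃ * μ (ball z r) * ⨍⁻ y in ball z (σ * r), W y ∂μ := by
                gcongr; exact hC₃ z r hr
            _ = _ := by ring
      _ ≤ _ := by gcongr
  -- the oscillation of `h`
  have hosc : meanOsc μ h z r ≤
      K' * ENNReal.ofReal r ^ (β : ℝ) * (C₃ ^ (1 / p) * (1 + C₁) * I ^ (1 / p)) := by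
    refine (hPoin h hhm _ hgh z r hr).trans ?_
    have hghZ : ∀ x, κ * (∑ j ∈ Finset.range k, G j) x ≤ (1 + C₁) * Z x := fun x => by
      calc κ * (∑ j ∈ Finset.range k, G j) x
          ≤ κ * ∑ j ∈ Finset.range k, (C₁ * (U j).indicator (fun _ => (t j : ℝ≥0∞)) x +
              F.indicator g x) := by
            rw [Finset.sum_apply]
            gcongr with j hj
            simp only [hG, Pi.add_apply]
            refine add_le_add (le_of_eq ?_) ?_
            · simp only [indicator_apply]
              split_ifs <;> simp
            -- Off U_j one has f ≤ t_j ≤ 2^{2k} l because j < k, so g is only seen on F.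
            · refine indicator_le_indicator_of_subset ?_ (fun _ => zero_le) x
              intro y hy
              have hy' : f y ≤ t j := not_lt.1 hy
              refine hy'.trans ?_
              rw [htc, mul_right_comm, ← pow_add]
              gcongr
              · norm_num
              · have := Finset.mem_range.1 hj
                omega
        _ = C₁ * W x + κ * k * F.indicator g x := by
            rw [Finset.sum_add_distrib, ← Finset.mul_sum, Finset.sum_const, Finset.card_range,
              nsmul_eq_mul]
            ring
        _ ≤ (1 + C₁) * (W x + F.indicator g x) := by
            rw [hκk, add_mul, mul_add, mul_add, one_mul, one_mul, add_comm]
            exact add_le_add le_add_self le_self_add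
    have hdiam : ENNReal.ofReal (K ^ (1 / p) * diam (ball z r) ^ (β : ℝ)) ≤
        K' * ENNReal.ofReal r ^ (β : ℝ) := by
      calc _ ≤ ENNReal.ofReal (K ^ (1 / p) * (2 * r) ^ (β : ℝ)) := by
            gcongr
            exact diam_ball hr.le
        _ = _ := by
            rw [ENNReal.ofReal_mul (by positivity), ← ENNReal.ofReal_rpow_of_nonneg (by positivity)
              β.coe_nonneg, ENNReal.ofReal_mul (by norm_num),
              ENNReal.mul_rpow_of_nonneg _ _ β.coe_nonneg, hK']
            push_cast [ENNReal.coe_rpow_of_nonneg _ β.coe_nonneg]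
            rw [ENNReal.ofReal_ofNat, mul_assoc, ENNReal.ofReal]
    refine mul_le_mul' hdiam ?_
    have h1c : (1 + C₁ : ℝ≥0∞) ^ p ≠ ∞ := ENNReal.rpow_ne_top_of_nonneg hp0.le (by simp)
    calc (⨍⁻ x in ball z (τ * r), (κ * (∑ j ∈ Finset.range k, G j) x) ^ p ∂μ) ^ (1 / p)
        ≤ (C₃ * ⨍⁻ x in ball z (σ * r), ((1 + C₁) * Z x) ^ p ∂μ) ^ (1 / p) := by
          refine ENNReal.rpow_le_rpow ?_ (by positivity)
          have hτr : 0 < τ * r := by positivity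
          have hsub : ball z (τ * r) ⊆ ball z (σ * r) := ball_subset_ball (by gcongr)
          have hμ : μ (ball z (σ * r)) ≤ C₃ * μ (ball z (τ * r)) := by
            refine (hC₃ z r hr).trans ?_
            gcongr
            nlinarith
          refine (setLAverage_le_mul_of_subset hsub (measure_ball_ne_zero μ hτr)
            (measure_ball_ne_top μ) hμ _).trans ?_
          exact mul_le_mul' le_rfl (setLAverage_mono_on measurableSet_ball fun x _ =>
            ENNReal.rpow_le_rpow (hghZ x) hp0.le)
      _ = _ := by
          simp only [ENNReal.mul_rpow_of_nonneg _ _ hp0.le]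
          rw [setLAverage_const_mul h1c, ENNReal.mul_rpow_of_nonneg _ _ (by positivity),
            ENNReal.mul_rpow_of_nonneg _ _ (by positivity), ← ENNReal.rpow_mul,
            mul_one_div_cancel hp0.ne', ENNReal.rpow_one, mul_assoc]
  calc meanOsc μ u z r ≤ 2 * ⨍⁻ y in ball z r, ‖u y - ⨍ w in ball z r, h w ∂μ‖ₑ ∂μ :=
        meanOsc_le_two_mul hβ hu hr _
    _ ≤ 2 * (⨍⁻ y in ball z r, ‖u y - h y‖ₑ ∂μ + meanOsc μ h z r) := by
        gcongr
        rw [meanOsc, setLAverage_eq, setLAverage_eq, setLAverage_eq, ← ENNReal.add_div,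
          ← lintegral_add_left]
        · gcongr with y
          rw [show u y - ⨍ w in ball z r, h w ∂μ = (u y - h y) + (h y - ⨍ w in ball z r, h w ∂μ) by
            ring]
          exact enorm_add_le _ _
        · exact ((D.continuous_of_memHolder hu).measurable.sub
            (D.continuous_of_memHolder hhm).measurable).enorm
    _ ≤ 2 * (C₂ * ENNReal.ofReal r ^ (β : ℝ) * (C₃ * I ^ (1 / p)) +
        K' * ENNReal.ofReal r ^ (β : ℝ) * (C₃ ^ (1 / p) * (1 + C₁) * I ^ (1 / p))) := by gcongr
    _ = _ := by
        push_cast [ENNReal.coe_rpow_of_nonneg _ (show 0 ≤ 1 / p by positivity)]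
        ring

end LocalEstimate

/-! ### Dyadic layer cake sums. -/

section LayerCake

variable {X : Type*} [MeasurableSpace X] {μ : Measure X}

/-- For finite y the last dyadic level below y already suffices, as y is at most twice that level.
For y = ∞ all terms are present and the series diverges. -/
theorem rpow_le_tsum_superlevel {p : ℝ} (hp : 0 < p) {l : ℝ≥0∞} (hl : l ≠ 0) {y : ℝ≥0∞}
    (hy : l < y) [∀ i : ℕ, Decidable (2 ^ i * l < y)] :
    y ^ p ≤ 2 ^ p * ∑' i : ℕ, (if 2 ^ i * l < y then (2 ^ i * l) ^ p else 0) := by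
  have hlt : l ≠ ∞ := hy.ne_top
  rcases eq_or_ne y ∞ with rfl | hyt
  · have h : ∑' i : ℕ, (if 2 ^ i * l < (∞ : ℝ≥0∞) then (2 ^ i * l) ^ p else 0) = ∞ := by
      refine top_unique ?_
      calc (∞ : ℝ≥0∞) = ∑' _ : ℕ, l ^ p :=
            (ENNReal.tsum_const_eq_top_of_ne_zero (by simp [hl, hp.not_gt])).symm
        _ ≤ _ := by
            gcongr with i
            rw [if_pos (ENNReal.mul_lt_top (ENNReal.pow_lt_top ENNReal.ofNat_lt_top) hlt.lt_top)]
            gcongr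
            exact le_mul_of_one_le_left' (one_le_pow₀ (by norm_num))
    rw [h, ENNReal.mul_top (by simp)]
    exact le_top
  · have hex : ∃ i : ℕ, y ≤ 2 ^ i * l := by
      obtain ⟨n, hn⟩ := ENNReal.exists_nat_mul_gt hl hyt
      refine ⟨n, hn.le.trans ?_⟩
      gcongr
      exact_mod_cast Nat.lt_two_pow_self.le
    classical
    have h1 := Nat.find_spec hex
    obtain ⟨i, hi⟩ : ∃ i, Nat.find hex = i + 1 := by
      refine Nat.exists_eq_succ_of_ne_zero fun h0 => ?_
      rw [h0, pow_zero, one_mul] at h1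
      exact absurd hy (not_lt.2 h1)
    have h2 : 2 ^ i * l < y := not_le.1 (Nat.find_min hex (m := i) (by omega))
    rw [hi] at h1
    calc y ^ p ≤ (2 ^ (i + 1) * l) ^ p := by gcongr
      _ = 2 ^ p * (if 2 ^ i * l < y then (2 ^ i * l) ^ p else 0) := by
          rw [if_pos h2, ← ENNReal.mul_rpow_of_nonneg _ _ hp.le]; ring_nf
      _ ≤ _ := by
          gcongr
          exact ENNReal.le_tsum (f := fun i : ℕ => if 2 ^ i * l < y then (2 ^ i * l) ^ p else 0) i

/-- A dyadic form of the layer cake formula. -/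
theorem lintegral_rpow_le_of_forall_tsum_le {p : ℝ} (hp : 0 < p) {f : X → ℝ≥0∞} (hf : Measurable f)
    {K : ℝ≥0∞} (h : ∀ n : ℕ, ∑' i : ℕ, (2 ^ i * ((2 ^ n : ℝ≥0)⁻¹ : ℝ≥0) : ℝ≥0∞) ^ p *
      μ {x | (2 ^ i * ((2 ^ n : ℝ≥0)⁻¹ : ℝ≥0) : ℝ≥0∞) < f x} ≤ K) :
    ∫⁻ x, f x ^ p ∂μ ≤ 2 ^ p * K := by
  classical
  set l : ℕ → ℝ≥0∞ := fun n => ((2 ^ n : ℝ≥0)⁻¹ : ℝ≥0) with hl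
  have hl0 : ∀ n, l n ≠ 0 := fun n => by simp [hl]
  have hanti : Antitone l := fun m n hmn => by
    simp only [hl, ENNReal.coe_le_coe]
    gcongr
    norm_num
  set s : ℕ → Set X := fun n => {x | l n < f x} with hs
  have hsm : ∀ c : ℝ≥0∞, MeasurableSet {x | c < f x} := fun c => measurableSet_lt measurable_const hf
  have hmono : Monotone s := fun m n hmn x hx => (hanti hmn).trans_lt hx
  have hsupp : ∫⁻ x, f x ^ p ∂μ = ∫⁻ x in ⋃ n, s n, f x ^ p ∂μ := by
    rw [← lintegral_indicator (MeasurableSet.iUnion fun n => hsm _)]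
    congr 1
    refine (indicator_eq_self.2 fun x hx => ?_).symm
    have hx0 : 0 < f x := by
      by_contra h0
      simp only [not_lt, nonpos_iff_eq_zero] at h0
      simp [h0, hp] at hx
    have hlim : Filter.Tendsto l Filter.atTop (nhds 0) := by
      rw [← ENNReal.coe_zero, hl, ENNReal.tendsto_coe]
      simp only [← inv_pow]
      exact NNReal.tendsto_pow_atTop_nhds_zero_of_lt_one (by
        rw [inv_lt_one₀ (by norm_num)]; norm_num)
    obtain ⟨n, hn⟩ := (hlim.eventually (gt_mem_nhds hx0)).exists
    exact mem_iUnion.2 ⟨n, hn⟩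
  -- The sets {f > 2^{-n}} exhaust {f > 0}, and the bound K does not depend on n.
  rw [hsupp, setLIntegral_iUnion_of_directed _ hmono.directed_le]
  refine iSup_le fun n => ?_
  calc ∫⁻ x in s n, f x ^ p ∂μ
      ≤ ∫⁻ x in s n, 2 ^ p * ∑' i : ℕ, (if 2 ^ i * l n < f x then (2 ^ i * l n) ^ p else 0) ∂μ :=
        setLIntegral_mono' (hsm _) fun x hx => rpow_le_tsum_superlevel hp (hl0 n) hx
    _ ≤ ∫⁻ x, 2 ^ p * ∑' i : ℕ, (if 2 ^ i * l n < f x then (2 ^ i * l n) ^ p else 0) ∂μ :=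
        setLIntegral_le_lintegral _ _
    _ = 2 ^ p * ∑' i : ℕ, (2 ^ i * l n) ^ p * μ {x | 2 ^ i * l n < f x} := by
        have hi : ∀ i : ℕ, (fun x => if 2 ^ i * l n < f x then (2 ^ i * l n) ^ p else 0) =
            {x | 2 ^ i * l n < f x}.indicator fun _ => (2 ^ i * l n) ^ p := fun i => by
          ext x
          simp only [indicator_apply, mem_ofPred_eq]
        rw [lintegral_const_mul' _ _ (ENNReal.rpow_ne_top_of_nonneg hp.le ENNReal.ofNat_ne_top),
          lintegral_tsum]
        · congr 2
          ext i
          rw [hi, lintegral_indicator_const (hsm _)]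
        · intro i
          rw [hi]
          exact (measurable_const.indicator (hsm _)).aemeasurable
    _ ≤ _ := by
        gcongr
        exact h n

/-- All indices satisfying P lie in a window of length N starting at the first one. -/
theorem tsum_ite_le_of_forall_lt_add {P : ℕ → Prop} [DecidablePred P] {N : ℕ}
    (h : ∀ i j, P i → P j → j < i + N) (c : ℝ≥0∞) :
    ∑' i, (if P i then c else 0) ≤ N * c := by
  by_cases hex : ∃ i, P i
  · rw [tsum_eq_sum (s := Finset.Ico (Nat.find hex) (Nat.find hex + N))]
    · calc _ ≤ ∑ _i ∈ Finset.Ico (Nat.find hex) (Nat.find hex + N), c := by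
            gcongr with i
            split_ifs <;> simp
        _ = _ := by simp
    · intro i hi
      refine if_neg fun hPi => hi (Finset.mem_Ico.2 ⟨Nat.find_min' hex hPi, ?_⟩)
      exact h _ _ (Nat.find_spec hex) hPi
  · push Not at hex
    simp [hex]

end LayerCake

/-! ### The level set inequality and absorption. -/

namespace DStructure

variable {X : Type*} [MetricSpace X] [MeasurableSpace X] [BorelSpace X] {p : ℝ} {β : ℝ≥0}
  {μ : Measure X} [IsDoublingSpace μ]

/-- Either the maximal function exceeds 2^k l on the whole ball, and the term j = 0 alone suffices
since k ≤ 2^k, or some point of the ball satisfies the hypothesis of the local estimate. The summand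
1 in the constant serves the first case. -/
theorem exists_rpow_mul_measure_ball_le (D : DStructure μ p β) :
    ∃ (C : ℝ≥0) (σ : ℝ) (m : ℕ), 1 ≤ σ ∧ ∀ u, MemHolder β u → ∀ g ∈ D.toFun u, ∀ k : ℕ, 0 < k →
      ∀ (l : ℝ≥0) (z : X) (r : ℝ), 0 < r → ENNReal.ofReal r ^ (β : ℝ) * l < meanOsc μ u z r →
        (l : ℝ≥0∞) ^ p * μ (ball z r) ≤
          C * ∫⁻ x in ball z (σ * r), levelIntegrand p k m l (oscMaximal μ β u) g x ∂μ := by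
  classical
  have hp := D.one_le_p
  have hp0 := D.p_pos
  obtain ⟨C, σ, hσ, hC⟩ := D.exists_meanOsc_le
  obtain ⟨m, hm⟩ := exists_lt_two_pow_mul_oscMaximal μ D.beta_pos σ hσ
  refine ⟨1 + C ^ p * 4 ^ p, σ, m, hσ, fun u hu g hg k hk l z r hr hl => ?_⟩
  set f := oscMaximal μ β u with hf
  have hsub : ball z r ⊆ ball z (σ * r) := ball_subset_ball (by nlinarith)
  by_cases hQ : ∀ y ∈ ball z r, 2 ^ k * (l : ℝ≥0∞) < f y
  · have hpt : ∀ y ∈ ball z r, (l : ℝ≥0∞) ^ p ≤ levelIntegrand p k m l f g y := fun y hy => by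
      calc (l : ℝ≥0∞) ^ p ≤ ((k : ℝ≥0∞)⁻¹ * (2 ^ k * (l : ℝ≥0∞))) ^ p := by
            gcongr
            rw [← mul_assoc]
            refine le_mul_of_one_le_left' ?_
            rw [mul_comm, ← div_eq_mul_inv, ENNReal.le_div_iff_mul_le (by simp) (by simp), one_mul]
            exact_mod_cast Nat.lt_two_pow_self.le
        _ = (k : ℝ≥0∞)⁻¹ ^ p * {x | 2 ^ k * (l : ℝ≥0∞) * 2 ^ 0 < f x}.indicator
              (fun _ => (2 ^ k * (l : ℝ≥0∞) * 2 ^ 0) ^ p) y := by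
            have : y ∈ {x | 2 ^ k * (l : ℝ≥0∞) * 2 ^ 0 < f x} := by simpa using hQ y hy
            rw [indicator_of_mem this, ENNReal.mul_rpow_of_nonneg _ _ hp0.le, pow_zero, mul_one]
        _ ≤ (k : ℝ≥0∞)⁻¹ ^ p * ∑ j ∈ Finset.range k,
              {x | 2 ^ k * (l : ℝ≥0∞) * 2 ^ j < f x}.indicator
                (fun _ => (2 ^ k * (l : ℝ≥0∞) * 2 ^ j) ^ p) y := by
            gcongr
            exact Finset.single_le_sum (f := fun j => {x | 2 ^ k * (l : ℝ≥0∞) * 2 ^ j < f x}.indicator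
                (fun _ => (2 ^ k * (l : ℝ≥0∞) * 2 ^ j) ^ p) y) (fun _ _ => zero_le)
                (Finset.mem_range.2 hk)
        _ ≤ _ := le_self_add
    calc (l : ℝ≥0∞) ^ p * μ (ball z r) = ∫⁻ _ in ball z r, (l : ℝ≥0∞) ^ p ∂μ := by
          rw [setLIntegral_const]
      _ ≤ ∫⁻ y in ball z r, levelIntegrand p k m l f g y ∂μ :=
          setLIntegral_mono' measurableSet_ball hpt
      _ ≤ ∫⁻ y in ball z (σ * r), levelIntegrand p k m l f g y ∂μ := lintegral_mono_set hsub
      _ ≤ _ := le_mul_of_one_le_left' (by push_cast; exact le_self_add)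
  · push Not at hQ
    obtain ⟨y₀, hy₀, hy₀l⟩ := hQ
    have h := hl.trans_le (hC u hu g hg k hk l z r y₀ hy₀ (not_lt.2 hy₀l))
    rw [mul_comm (C : ℝ≥0∞), mul_assoc] at h
    have h2 := (lt_of_mul_lt_mul_left' h).le
    set I := ⨍⁻ x in ball z (σ * r), ((k : ℝ≥0∞)⁻¹ * ∑ j ∈ Finset.range k,
            (if 2 ^ k * (l : ℝ≥0∞) * 2 ^ j < f x then 2 ^ k * (l : ℝ≥0∞) * 2 ^ j else 0) +
            {x | f x ≤ 2 ^ (2 * k) * (l : ℝ≥0∞)}.indicator g x) ^ p ∂μ with hI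
    have hσr : 0 < σ * r := by positivity
    have hI2 : I ≤ 4 ^ p * ⨍⁻ x in ball z (σ * r), levelIntegrand p k m l f g x ∂μ := by
      rw [← setLAverage_const_mul (ENNReal.rpow_ne_top_of_nonneg hp0.le ENNReal.ofNat_ne_top)]
      exact setLAverage_mono_on measurableSet_ball fun x hx =>
        rpow_add_indicator_le hp (hm u hu l z r hr hl x hx)
    calc (l : ℝ≥0∞) ^ p * μ (ball z r) ≤ (C * I ^ (1 / p)) ^ p * μ (ball z r) := by gcongr
      _ = C ^ p * I * μ (ball z r) := by
          rw [ENNReal.mul_rpow_of_nonneg _ _ hp0.le, ← ENNReal.rpow_mul, one_div_mul_cancel hp0.ne',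
            ENNReal.rpow_one]
      _ ≤ C ^ p * (4 ^ p * ⨍⁻ x in ball z (σ * r), levelIntegrand p k m l f g x ∂μ) *
            μ (ball z (σ * r)) := by gcongr
      _ = C ^ p * 4 ^ p * ∫⁻ x in ball z (σ * r), levelIntegrand p k m l f g x ∂μ := by
          rw [setLAverage_eq, mul_assoc, mul_assoc, mul_assoc,
            ENNReal.div_mul_cancel (measure_ball_ne_zero μ hσr) (measure_ball_ne_top μ)]
      _ ≤ _ := by
          gcongr
          push_cast [ENNReal.coe_rpow_of_nonneg _ hp0.le]
          exact le_add_self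

theorem exists_measure_superlevel_le (D : DStructure μ p β) :
    ∃ (C : ℝ≥0) (m : ℕ), ∀ u, MemHolder β u → ∀ g ∈ D.toFun u, ∀ k : ℕ, 0 < k →
      ∀ (l : ℝ≥0), (l : ℝ≥0∞) ^ p * μ {x | (l : ℝ≥0∞) < oscMaximal μ β u x} ≤
          C * ∫⁻ x, levelIntegrand p k m l (oscMaximal μ β u) g x ∂μ := by
  obtain ⟨C, σ, m, hσ, hC⟩ := D.exists_rpow_mul_measure_ball_le
  obtain ⟨C', hC'⟩ := exists_measure_ball_mul_le μ (5 * σ)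
  refine ⟨C' * C, m, fun u hu g hg k hk l => ?_⟩
  have hCt : ((C' * C : ℝ≥0) : ℝ≥0∞) ≠ ∞ := ENNReal.coe_ne_top
  rw [← setLIntegral_const, ← lintegral_const_mul' _ _ hCt]
  refine lintegral_le_of_ball_covering μ fun x hx => ?_
  obtain ⟨z, r, hr, hxr, hl⟩ := lt_oscMaximal_iff.1 hx
  have hσr : r ≤ σ * r := by nlinarith
  refine ⟨z, σ * r, by positivity, ball_subset_ball hσr hxr, ?_⟩
  rw [setLIntegral_const, lintegral_const_mul' _ _ hCt, ← mul_assoc 5]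
  calc (l : ℝ≥0∞) ^ p * μ (ball z (5 * σ * r)) ≤ (l : ℝ≥0∞) ^ p * (C' * μ (ball z r)) := by
        gcongr; exact hC' z r hr
    _ = C' * ((l : ℝ≥0∞) ^ p * μ (ball z r)) := by ring
    _ ≤ C' * (C * _) := mul_le_mul' le_rfl (hC u hu g hg k hk l z r hr hl)
    _ = _ := by push_cast; ring

/-- The weak-type bound coming directly from Poincaré's inequality. Alone it does not give the
strong bound; it is used to know that each term of the dyadic sum is finite. -/
theorem exists_measure_superlevel_le_lintegral (D : DStructure μ p β) :
    ∃ C : ℝ≥0, ∀ u, MemHolder β u → ∀ g ∈ D.toFun u, ∀ l : ℝ≥0,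
      (l : ℝ≥0∞) ^ p * μ {x | (l : ℝ≥0∞) < oscMaximal μ β u x} ≤ C * ∫⁻ x, g x ^ p ∂μ := by
  have hp0 := D.p_pos
  obtain ⟨K, τ, hK, hτ, hPoin⟩ := D.poincare
  obtain ⟨C', hC'⟩ := exists_measure_ball_mul_le μ (5 * τ)
  set K' : ℝ≥0 := (K ^ (1 / p)).toNNReal * 2 ^ (β : ℝ) with hK'
  refine ⟨C' * K' ^ p, fun u hu g hg l => ?_⟩
  have hCt : ((C' * K' ^ p : ℝ≥0) : ℝ≥0∞) ≠ ∞ := ENNReal.coe_ne_top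
  rw [← setLIntegral_const, ← lintegral_const_mul' _ _ hCt]
  refine lintegral_le_of_ball_covering μ fun x hx => ?_
  obtain ⟨z, r, hr, hxr, hl⟩ := lt_oscMaximal_iff.1 hx
  have hτr : r ≤ τ * r := by nlinarith
  have hτr0 : 0 < τ * r := by positivity
  refine ⟨z, τ * r, by positivity, ball_subset_ball hτr hxr, ?_⟩
  rw [setLIntegral_const, lintegral_const_mul' _ _ hCt, ← mul_assoc 5]
  have hdiam : ENNReal.ofReal (K ^ (1 / p) * diam (ball z r) ^ (β : ℝ)) ≤
      ENNReal.ofReal r ^ (β : ℝ) * K' := by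
    calc _ ≤ ENNReal.ofReal (K ^ (1 / p) * (2 * r) ^ (β : ℝ)) := by
          gcongr
          exact diam_ball hr.le
      _ = _ := by
          rw [ENNReal.ofReal_mul (by positivity), ← ENNReal.ofReal_rpow_of_nonneg (by positivity)
            β.coe_nonneg, ENNReal.ofReal_mul (by norm_num),
            ENNReal.mul_rpow_of_nonneg _ _ β.coe_nonneg, hK']
          push_cast [ENNReal.coe_rpow_of_nonneg _ β.coe_nonneg]
          rw [ENNReal.ofReal_ofNat, ENNReal.ofReal]
          ring
  have h := hl.trans_le ((hPoin u hu g hg z r hr).trans (mul_le_mul' hdiam le_rfl))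
  rw [mul_assoc] at h
  have h2 := (lt_of_mul_lt_mul_left' h).le
  calc (l : ℝ≥0∞) ^ p * μ (ball z (5 * τ * r)) ≤
        (K' * (⨍⁻ x in ball z (τ * r), g x ^ p ∂μ) ^ (1 / p)) ^ p * (C' * μ (ball z (τ * r))) := by
        gcongr
        exact (hC' z r hr).trans (by gcongr)
    _ = C' * K' ^ p * ((⨍⁻ x in ball z (τ * r), g x ^ p ∂μ) * μ (ball z (τ * r))) := by
        rw [ENNReal.mul_rpow_of_nonneg _ _ hp0.le, ← ENNReal.rpow_mul, one_div_mul_cancel hp0.ne',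
            ENNReal.rpow_one]
        ring
    _ = _ := by
        rw [setLAverage_eq, ENNReal.div_mul_cancel (measure_ball_ne_zero μ hτr0)
          (measure_ball_ne_top μ)]
        push_cast [ENNReal.coe_rpow_of_nonneg _ hp0.le]
        rfl

/-- The boundedness of the fractional sharp maximal function: its `L^p`-norm is controlled by that
of every `g ∈ 𝒟(u)`. -/
theorem exists_lintegral_oscMaximal_rpow_le (D : DStructure μ p β) (hp : 1 < p) :
    ∃ C : ℝ≥0, 0 < C ∧ ∀ u, MemHolder β u → ∀ g ∈ D.toFun u,
      ∫⁻ x, oscMaximal μ β u x ^ p ∂μ ≤ C * ∫⁻ x, g x ^ p ∂μ := by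
  classical
  have hp0 := D.p_pos
  obtain ⟨C, m, hC⟩ := D.exists_measure_superlevel_le
  obtain ⟨C', hC'⟩ := D.exists_measure_superlevel_le_lintegral
  obtain ⟨k, hk, hkC⟩ := exists_nat_mul_inv_rpow_mul_le hp C
  refine ⟨1 + 2 ^ p * (2 * (C * (m + 2 * k : ℕ))), by positivity, fun u hu g hg => ?_⟩
  set J := ∫⁻ x, g x ^ p ∂μ with hJ
  rcases eq_or_ne J ∞ with hJt | hJt
  · rw [hJt, ENNReal.mul_top (by simp)]
    exact le_top
  set f := oscMaximal μ β u with hf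
  have hfm : Measurable f := measurable_ballSup _
  have hgm : AEMeasurable (fun x => g x ^ p) μ := (D.aemeasurable u hu g hg).pow_const p
  have hmeas : ∀ c : ℝ≥0∞, MeasurableSet {x | c < f x} :=
    fun c => measurableSet_lt measurable_const hfm
  refine (lintegral_rpow_le_of_forall_tsum_le hp0 hfm
    (K := 2 * (C * (m + 2 * k : ℕ)) * J) fun n => ?_).trans ?_
  swap
  · rw [← mul_assoc]
    gcongr
    push_cast [ENNReal.coe_rpow_of_nonneg _ hp0.le]
    exact le_add_self
  set l₀ : ℝ≥0 := (2 ^ n : ℝ≥0)⁻¹ with hl₀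
  have hl₀0 : 0 < l₀ := by positivity
  set l : ℕ → ℝ≥0 := fun i => 2 ^ i * l₀ with hl
  have hlc : ∀ i, (l i : ℝ≥0∞) = 2 ^ i * (l₀ : ℝ≥0∞) := fun i => by simp [hl]
  have hlk : ∀ i j, 2 ^ k * (l i : ℝ≥0∞) * 2 ^ j = l (i + (k + j)) := fun i j => by
    rw [hlc, hlc, pow_add, pow_add]; ring
  simp only [← hlc]
  set s : ℕ → ℝ≥0∞ := fun i => (l i : ℝ≥0∞) ^ p * μ {x | (l i : ℝ≥0∞) < f x} with hs
  set F : ℕ → Set X := fun i => {x | (l i : ℝ≥0∞) < 2 ^ m * f x ∧ f x ≤ 2 ^ (2 * k) * (l i : ℝ≥0∞)}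
    with hF
  have hFm : ∀ i, MeasurableSet (F i) := fun i =>
    (measurableSet_lt measurable_const (hfm.const_mul _)).inter
      (measurableSet_le hfm measurable_const)
  have hsi : ∀ i, s i ≤ C * ((k : ℝ≥0∞)⁻¹ ^ p * ∑ j ∈ Finset.range k, s (i + (k + j)) +
      ∫⁻ x, (F i).indicator (fun x => g x ^ p) x ∂μ) := fun i => by
    refine (hC u hu g hg k hk (l i)).trans (le_of_eq ?_)
    have hkt : (k : ℝ≥0∞)⁻¹ ^ p ≠ ∞ :=
      ENNReal.rpow_ne_top_of_nonneg hp0.le (ENNReal.inv_ne_top.2 (by positivity))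
    simp only [levelIntegrand, hlk, ← hf]
    rw [lintegral_add_left, lintegral_const_mul' _ _ hkt, lintegral_finsetSum]
    · simp only [lintegral_indicator_const (hmeas _), hs, hF]
    · exact fun j _ => measurable_const.indicator (hmeas _)
    · exact (Finset.measurable_sum _ fun j _ => measurable_const.indicator (hmeas _)).const_mul _
  -- At a given point, the levels l_i with 2^{-m} l_i < f ≤ 2^{2k} l_i number at most m + 2k.
  have hFsum : ∑' i, ∫⁻ x, (F i).indicator (fun x => g x ^ p) x ∂μ ≤ (m + 2 * k : ℕ) * J := by
    rw [← lintegral_tsum fun i => hgm.indicator (hFm i), hJ,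
      ← lintegral_const_mul' _ _ (ENNReal.natCast_ne_top _)]
    refine lintegral_mono fun x => ?_
    simp only [indicator_apply]
    refine tsum_ite_le_of_forall_lt_add (fun i j hi hj => ?_) _
    have h1 : (l j : ℝ≥0∞) < l (i + (m + 2 * k)) := by
      refine hj.1.trans_le ?_
      calc 2 ^ m * f x ≤ 2 ^ m * (2 ^ (2 * k) * (l i : ℝ≥0∞)) := by gcongr; exact hi.2
        _ = _ := by rw [hlc, hlc, pow_add, pow_add]; ring
    simp only [hl, ENNReal.coe_lt_coe] at h1
    exact (pow_lt_pow_iff_right₀ (one_lt_two (α := ℝ≥0))).1 (lt_of_mul_lt_mul_right h1 hl₀0.le)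
  set S := ∑' i, s i with hS
  -- Since u is Hölder, f is bounded, so only finitely many levels 2^i l₀ contribute; each
  -- contribution is finite by the weak-type bound.
  have hSt : S ≠ ∞ := by
    obtain ⟨κ, hκ⟩ := hu
    have hl1 : (l₀ : ℝ≥0∞) ≠ 0 := by exact_mod_cast hl₀0.ne'
    obtain ⟨N, hN⟩ := ENNReal.exists_nat_mul_gt hl1
      (ENNReal.mul_ne_top ENNReal.ofNat_ne_top (ENNReal.coe_ne_top (r := κ)) : (2 * κ : ℝ≥0∞) ≠ ∞)
    have hzero : ∀ i ∉ Finset.range N, s i = 0 := fun i hi => by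
      have hempty : {x | (l i : ℝ≥0∞) < f x} = ∅ := by
        refine eq_empty_of_forall_notMem fun x (hx : (l i : ℝ≥0∞) < f x) => absurd hx (not_lt.2 ?_)
        refine (oscMaximal_le_of_holderWith D.beta_pos hκ x).trans (hN.le.trans ?_)
        rw [hlc]
        gcongr
        have h1 : N ≤ i := by simpa using hi
        exact_mod_cast h1.trans Nat.lt_two_pow_self.le
      simp [hs, hempty]
    rw [hS, tsum_eq_sum hzero]
    refine ENNReal.sum_ne_top.2 fun i _ => ?_
    exact ne_top_of_le_ne_top (ENNReal.mul_ne_top ENNReal.coe_ne_top hJt)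
      (hC' u ⟨κ, hκ⟩ g hg (l i))
  have hshift : ∀ N, ∑' i, s (i + N) ≤ S := fun N =>
    ENNReal.tsum_comp_le_tsum_of_injective (add_left_injective N) s
  -- Each of the k shifted series is at most S, which gives C k^{-p} k S, at most half of S by the
  -- choice of k.
  have hmain : S ≤ 2⁻¹ * S + C * (m + 2 * k : ℕ) * J := by
    calc S ≤ ∑' i, C * ((k : ℝ≥0∞)⁻¹ ^ p * ∑ j ∈ Finset.range k, s (i + (k + j)) +
          ∫⁻ x, (F i).indicator (fun x => g x ^ p) x ∂μ) := ENNReal.tsum_le_tsum hsi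
      _ = C * ((k : ℝ≥0∞)⁻¹ ^ p * ∑ j ∈ Finset.range k, ∑' i, s (i + (k + j)) +
          ∑' i, ∫⁻ x, (F i).indicator (fun x => g x ^ p) x ∂μ) := by
          rw [ENNReal.tsum_mul_left, ENNReal.tsum_add, ENNReal.tsum_mul_left,
            Summable.tsum_finsetSum fun _ _ => ENNReal.summable]
      _ ≤ C * ((k : ℝ≥0∞)⁻¹ ^ p * ∑ _j ∈ Finset.range k, S + (m + 2 * k : ℕ) * J) := by
          gcongr
          exact hshift _
      _ = C * ((k : ℝ≥0∞)⁻¹ ^ p * k) * S + C * (m + 2 * k : ℕ) * J := by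
          rw [Finset.sum_const, Finset.card_range, nsmul_eq_mul]; ring
      _ ≤ _ := by gcongr
  have h2S : 2⁻¹ * S ≤ C * (m + 2 * k : ℕ) * J := by
    have hhalf : S = 2⁻¹ * S + 2⁻¹ * S := by rw [← add_mul, ENNReal.inv_two_add_inv_two, one_mul]
    have hht : 2⁻¹ * S ≠ ∞ := ENNReal.mul_ne_top (by simp) hSt
    exact (ENNReal.add_le_add_iff_left hht).1 (hhalf.symm.le.trans hmain)
  calc S = 2 * (2⁻¹ * S) := by
        rw [← mul_assoc, ENNReal.mul_inv_cancel (by simp) (by simp), one_mul]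
    _ ≤ 2 * (C * (m + 2 * k : ℕ) * J) := by gcongr
    _ = _ := by ring

end DStructure

/-! ### The Hardy–Littlewood maximal theorem. -/

section HardyLittlewood

variable {X : Type*} [MetricSpace X] [MeasurableSpace X]

/-- The noncentered Hardy–Littlewood maximal function. -/
noncomputable def maximalFunction (μ : Measure X) (h : X → ℝ≥0∞) : X → ℝ≥0∞ :=
  ballSup fun z r => ⨍⁻ y in ball z r, h y ∂μ

variable [BorelSpace X]

/-- The part of h below height l adds at most l to any average, so an average above 2l forces the
part above height l to average more than l. -/
theorem exists_measure_lt_maximalFunction_le (μ : Measure X) [IsDoublingSpace μ] :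
    ∃ C : ℝ≥0, ∀ h : X → ℝ≥0∞, ∀ l : ℝ≥0,
      l * μ {x | 2 * (l : ℝ≥0∞) < maximalFunction μ h x} ≤
        C * ∫⁻ x, {x | (l : ℝ≥0∞) < h x}.indicator h x ∂μ := by
  obtain ⟨C, hC⟩ := exists_measure_ball_mul_le μ 5
  refine ⟨C, fun h l => ?_⟩
  set h₁ := {x | (l : ℝ≥0∞) < h x}.indicator h with hh₁
  rw [← setLIntegral_const, ← lintegral_const_mul' _ _ ENNReal.coe_ne_top]
  refine lintegral_le_of_ball_covering μ fun x hx => ?_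
  obtain ⟨z, r, hr, hxr, hl⟩ := lt_ballSup_iff.1 hx
  refine ⟨z, r, hr, hxr, ?_⟩
  rw [setLIntegral_const, lintegral_const_mul' _ _ ENNReal.coe_ne_top]
  have hB0 := measure_ball_ne_zero μ (x := z) hr
  have hBt := measure_ball_ne_top μ (x := z) (r := r)
  have hpt : ∀ y, h y ≤ l + h₁ y := fun y => by
    by_cases hy : (l : ℝ≥0∞) < h y
    · rw [hh₁, indicator_of_mem (by exact hy)]
      exact le_add_self
    · exact (not_lt.1 hy).trans le_self_add
  have hav : ⨍⁻ y in ball z r, h y ∂μ ≤ l + ⨍⁻ y in ball z r, h₁ y ∂μ := by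
    refine (setLAverage_mono_on measurableSet_ball fun y _ => hpt y).trans (le_of_eq ?_)
    rw [setLAverage_eq, lintegral_add_left measurable_const, setLIntegral_const, ENNReal.add_div,
      ENNReal.mul_div_cancel_right hB0 hBt, ← setLAverage_eq]
  have h1 : (l : ℝ≥0∞) < ⨍⁻ y in ball z r, h₁ y ∂μ := by
    have := hl.trans_le hav
    rw [two_mul] at this
    exact lt_of_add_lt_add_left this
  calc (l : ℝ≥0∞) * μ (ball z (5 * r))
      ≤ (⨍⁻ y in ball z r, h₁ y ∂μ) * (C * μ (ball z r)) := by
        gcongr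
        exact hC z r hr
    _ = C * ((⨍⁻ y in ball z r, h₁ y ∂μ) * μ (ball z r)) := by ring
    _ = _ := by rw [setLAverage_eq, ENNReal.div_mul_cancel hB0 hBt]

/-- The Hardy–Littlewood maximal theorem. -/
theorem exists_lintegral_maximalFunction_rpow_le (μ : Measure X) [IsDoublingSpace μ] {a : ℝ}
    (ha : 1 < a) :
    ∃ C : ℝ≥0, ∀ h : X → ℝ≥0∞, Measurable h →
      ∫⁻ x, maximalFunction μ h x ^ a ∂μ ≤ C * ∫⁻ x, h x ^ a ∂μ := by
  classical
  obtain ⟨C, hC⟩ := exists_measure_lt_maximalFunction_le μ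
  have ha0 : 0 < a := by linarith
  have ha1 : 0 < a - 1 := by linarith
  set b : ℝ≥0∞ := 2 ^ (a - 1) with hb
  have hb1 : 1 < b := ENNReal.one_lt_rpow (by norm_num) ha1
  have hbt : b ≠ ∞ := ENNReal.rpow_ne_top_of_nonneg ha1.le ENNReal.ofNat_ne_top
  set K : ℝ≥0∞ := (1 - b⁻¹)⁻¹ with hK
  have hKt : K ≠ ∞ := by
    rw [hK, ENNReal.inv_ne_top, Ne, tsub_eq_zero_iff_le, not_le]
    exact ENNReal.inv_lt_one.2 hb1
  refine ⟨2 ^ a * (2 ^ a * C * K.toNNReal), fun h hh => ?_⟩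
  set J := ∫⁻ x, h x ^ a ∂μ with hJ
  have h2a : (2 : ℝ≥0∞) ^ a ≠ ∞ := ENNReal.rpow_ne_top_of_nonneg ha0.le ENNReal.ofNat_ne_top
  refine (lintegral_rpow_le_of_forall_tsum_le ha0 (measurable_ballSup _)
    (K := 2 ^ a * C * K * J) fun n => ?_).trans (le_of_eq ?_)
  swap
  · push_cast [ENNReal.coe_rpow_of_nonneg _ ha0.le, ENNReal.coe_toNNReal hKt]
    ring
  -- Halved because the weak-type bound at height l concerns the superlevel set at 2l.
  set l₀ : ℝ≥0 := (2 ^ n : ℝ≥0)⁻¹ / 2 with hl₀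
  set l : ℕ → ℝ≥0 := fun i => 2 ^ i * l₀ with hl
  have hl2 : ∀ i : ℕ, (2 ^ i * ((2 ^ n : ℝ≥0)⁻¹ : ℝ≥0) : ℝ≥0∞) = 2 * (l i : ℝ≥0∞) := fun i => by
    have h1 : (2 : ℝ≥0) ^ i * (2 ^ n : ℝ≥0)⁻¹ = 2 * l i := by
      simp only [hl, hl₀]; field_simp
    exact_mod_cast congrArg ((↑) : ℝ≥0 → ℝ≥0∞) h1
  simp only [hl2]
  have hmeas : ∀ i, MeasurableSet {x | (l i : ℝ≥0∞) < h x} :=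
    fun i => measurableSet_lt measurable_const hh
  have hlpow : ∀ i, (l i : ℝ≥0∞) ^ (a - 1) = (l₀ : ℝ≥0∞) ^ (a - 1) * b ^ i := fun i => by
    simp only [hl]
    push_cast
    rw [ENNReal.mul_rpow_of_nonneg _ _ ha1.le, hb, mul_comm, ← ENNReal.rpow_natCast,
      ← ENNReal.rpow_natCast, ← ENNReal.rpow_mul, ← ENNReal.rpow_mul, mul_comm (i : ℝ)]
  have hone : ∀ y : ℝ≥0∞, y ^ a = y ^ (a - 1) * y := fun y => by
    rw [← sub_add_cancel a 1, ENNReal.rpow_add_of_nonneg _ _ ha1.le zero_le_one, ENNReal.rpow_one]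
    ring_nf
  have hterm : ∀ i, (2 * (l i : ℝ≥0∞)) ^ a * μ {x | 2 * (l i : ℝ≥0∞) < maximalFunction μ h x} ≤
      2 ^ a * C * ∫⁻ x, (if (l i : ℝ≥0∞) < h x then (l i : ℝ≥0∞) ^ (a - 1) else 0) * h x ∂μ := by
    intro i
    have hlt : (l i : ℝ≥0∞) ^ (a - 1) ≠ ∞ := ENNReal.rpow_ne_top_of_nonneg ha1.le ENNReal.coe_ne_top
    calc _ = 2 ^ a * (l i : ℝ≥0∞) ^ (a - 1) *
          (l i * μ {x | 2 * (l i : ℝ≥0∞) < maximalFunction μ h x}) := by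
          rw [ENNReal.mul_rpow_of_nonneg _ _ ha0.le, hone (l i)]; ring
      _ ≤ 2 ^ a * (l i : ℝ≥0∞) ^ (a - 1) *
          (C * ∫⁻ x, {x | (l i : ℝ≥0∞) < h x}.indicator h x ∂μ) := by
          exact mul_le_mul' le_rfl (hC h (l i))
      _ = 2 ^ a * C * ∫⁻ x, (l i : ℝ≥0∞) ^ (a - 1) * {x | (l i : ℝ≥0∞) < h x}.indicator h x ∂μ := by
          rw [lintegral_const_mul' _ _ hlt]; ring
      _ = _ := by
          congr 2
          ext x
          simp only [indicator_apply, mem_ofPred_eq]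
          split_ifs <;> simp
  calc _ ≤ ∑' i, 2 ^ a * C * ∫⁻ x, (if (l i : ℝ≥0∞) < h x then (l i : ℝ≥0∞) ^ (a - 1) else 0) * h x ∂μ :=
        ENNReal.tsum_le_tsum hterm
    _ = 2 ^ a * C * ∫⁻ x, (∑' i, if (l i : ℝ≥0∞) < h x then (l i : ℝ≥0∞) ^ (a - 1) else 0) * h x ∂μ := by
        rw [ENNReal.tsum_mul_left, ← lintegral_tsum]
        · simp only [ENNReal.tsum_mul_right]
        · exact fun i => ((Measurable.ite (hmeas i) measurable_const measurable_const).mul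
            hh).aemeasurable
    _ ≤ 2 ^ a * C * ∫⁻ x, K * h x ^ a ∂μ := by
        refine mul_le_mul' le_rfl (lintegral_mono fun x => ?_)
        dsimp only
        rw [hone (h x), ← mul_assoc]
        refine mul_le_mul' ?_ le_rfl
        refine ENNReal.tsum_le_of_sum_range_le fun N => ?_
        -- The levels below h(x) contribute a geometric sum of ratio 2^{a-1} > 1, controlled by
        -- h(x)^{a-1}.
        refine sum_ite_le_mul (v := fun i => (l i : ℝ≥0∞) ^ (a - 1)) (fun n => ?_) _ N
          fun i _ hi => ENNReal.rpow_le_rpow hi.le ha1.le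
        simp only [hlpow]
        exact sum_range_succ_mul_pow_le hb1 hbt _ n
    _ = _ := by rw [lintegral_const_mul' _ _ hKt]; ring

end HardyLittlewood

/-! ### A Sobolev–Poincaré inequality. -/

section SobolevPoincare

variable {X : Type*} [MetricSpace X] [MeasurableSpace X] [BorelSpace X] {β : ℝ≥0}

/-- The normalized oscillation b of the ball is a lower bound for the maximal function on the whole
ball. In b = b^{1-qδ} (b^q)^δ the first factor is bounded by the value at the center, the second by
an average. -/
theorem meanOsc_le_rpow_mul_rpow {μ : Measure X} [IsDoublingSpace μ] {u : X → ℝ} {q δ : ℝ}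
    (hq : 0 < q) (hδ : 0 < δ) (hqδ : q * δ ≤ 1) {x : X} {ρ : ℝ} (hρ : 0 < ρ) :
    meanOsc μ u x ρ ≤ ENNReal.ofReal ρ ^ (β : ℝ) * (oscMaximal μ β u x ^ (1 - q * δ) *
      (⨍⁻ y in ball x ρ, oscMaximal μ β u y ^ q ∂μ) ^ δ) := by
  set b := meanOsc μ u x ρ / ENNReal.ofReal ρ ^ (β : ℝ) with hb
  have hbf : ∀ y ∈ ball x ρ, b ≤ oscMaximal μ β u y := fun y hy =>
    le_ballSup (F := fun z r => meanOsc μ u z r / ENNReal.ofReal r ^ (β : ℝ)) hρ hy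
  have h1 : b ^ q ≤ ⨍⁻ y in ball x ρ, oscMaximal μ β u y ^ q ∂μ :=
    le_setLAverage_of_forall_le measurableSet_ball (measure_ball_ne_zero μ hρ)
      (measure_ball_ne_top μ) fun y hy => ENNReal.rpow_le_rpow (hbf y hy) hq.le
  have h2 : b = b ^ (1 - q * δ) * (b ^ q) ^ δ := by
    rw [← ENNReal.rpow_mul, ← ENNReal.rpow_add_of_nonneg _ _ (by linarith) (by positivity),
      sub_add_cancel, ENNReal.rpow_one]
  calc meanOsc μ u x ρ = ENNReal.ofReal ρ ^ (β : ℝ) * b := by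
        rw [hb, ENNReal.mul_div_cancel (ofReal_rpow_ne_zero hρ) (ofReal_rpow_ne_top β.coe_nonneg)]
    _ ≤ _ := by
        nth_rewrite 1 [h2]
        refine mul_le_mul' le_rfl (mul_le_mul' (ENNReal.rpow_le_rpow ?_ (by linarith))
          (ENNReal.rpow_le_rpow h1 hδ.le))
        exact hbf x (mem_ball_self hρ)

/-- A Sobolev–Poincaré inequality for the fractional sharp maximal function. -/
theorem exists_setLAverage_rpow_le_maximalFunction (μ : Measure X) [IsDoublingSpace μ]
    (hβ : 0 < β) {p : ℝ} (hp : 0 < p) :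
    ∃ (C : ℝ≥0) (q : ℝ), 0 < q ∧ q < p ∧ ∀ u : X → ℝ, MemHolder β u → ∀ (z : X) (r : ℝ),
      ∀ y₀ ∈ ball z r, ⨍⁻ x in ball z r, ‖u x - ⨍ w in ball z r, u w ∂μ‖ₑ ^ p ∂μ ≤
        C * ENNReal.ofReal r ^ ((β : ℝ) * p) *
          maximalFunction μ (fun x => oscMaximal μ β u x ^ q) y₀ ^ (p / q) := by
  obtain ⟨s, hs0, hs⟩ := exists_doubling_exponent μ
  have hβ' : 0 < (β : ℝ) := hβ
  -- Replacing averages over balls of radius 2^{-i} r by one over a large ball costs 2^{siδ} =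
  -- 2^{iβ/2}, half of the decay 2^{-iβ}, so the series still converges.
  set δ : ℝ := β / (2 * s) with hδ
  have hs0' : (0 : ℝ) < s := by exact_mod_cast hs0
  have hδ0 : 0 < δ := by positivity
  have hsδ : s * δ = β / 2 := by rw [hδ]; field_simp
  -- Chosen so that (1 - qδ)p = q: the p-th power of the pointwise bound then contains f^q, whose
  -- average is again at most a multiple of A.
  set q : ℝ := p / (1 + p * δ) with hq
  have hq0 : 0 < q := by positivity
  have hqp : q < p := by
    rw [hq, div_lt_iff₀ (by positivity)]
    nlinarith [mul_pos hp (mul_pos hp hδ0)]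
  have hqδ : (1 - q * δ) * p = q := by rw [hq]; field_simp; ring
  have hqδ1 : 0 < 1 - q * δ := by
    by_contra h
    have := mul_nonpos_of_nonpos_of_nonneg (not_lt.1 h) hp.le
    linarith
  have hpq : 1 + δ * p = p / q := by rw [hq]; field_simp
  set K : ℝ≥0∞ := 2 ^ (2 * s + 1) * (2 ^ (β : ℝ) * 2 ^ ((β : ℝ) / 2) *
    ∑' i : ℕ, ((2⁻¹ : ℝ≥0∞) ^ ((β : ℝ) / 2)) ^ i) with hK
  have hKt : K ≠ ∞ := by
    have := tsum_half_rpow_pow_ne_top (half_pos hβ')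
    have h1 : (2 : ℝ≥0∞) ^ (β : ℝ) ≠ ∞ :=
      ENNReal.rpow_ne_top_of_nonneg β.coe_nonneg ENNReal.ofNat_ne_top
    have h2 : (2 : ℝ≥0∞) ^ ((β : ℝ) / 2) ≠ ∞ :=
      ENNReal.rpow_ne_top_of_nonneg (half_pos hβ').le ENNReal.ofNat_ne_top
    exact ENNReal.mul_ne_top (ENNReal.pow_ne_top ENNReal.ofNat_ne_top)
      (ENNReal.mul_ne_top (ENNReal.mul_ne_top h1 h2) this)
  refine ⟨K.toNNReal ^ p * 2 ^ (s * 2), q, hq0, hqp, fun u hu z r y₀ hy₀ => ?_⟩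
  have hr : 0 < r := pos_of_mem_ball hy₀
  have h3r : 0 < 3 * r := by positivity
  set f := oscMaximal μ β u with hf
  set A := maximalFunction μ (fun x => f x ^ q) y₀ with hA
  have hA3 : ⨍⁻ y in ball z (3 * r), f y ^ q ∂μ ≤ A :=
    le_ballSup (F := fun z r => ⨍⁻ y in ball z r, f y ^ q ∂μ) h3r
      (ball_subset_ball (by linarith) hy₀)
  have hpt : ∀ x ∈ ball z r, ‖u x - ⨍ w in ball z r, u w ∂μ‖ₑ ≤
      K * ENNReal.ofReal r ^ (β : ℝ) * (f x ^ (1 - q * δ) * A ^ δ) := fun x hx => by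
    have hxz := mem_ball.1 hx
    have hav : ∀ i : ℕ, ⨍⁻ y in ball x (2 * r * (1 / 2) ^ i), f y ^ q ∂μ ≤
        2 ^ (s * (i + 1)) * A := fun i => by
      refine le_trans ?_ (mul_le_mul' le_rfl hA3)
      have hpos : 0 < 2 * r * (1 / 2) ^ i := by positivity
      have hle1 : (1 / 2 : ℝ) ^ i ≤ 1 := pow_le_one₀ (by norm_num) (by norm_num)
      refine setLAverage_le_mul_of_subset (ball_subset_ball' ?_) (measure_ball_ne_zero μ hpos)
        (measure_ball_ne_top μ) ?_ _
      · nlinarith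
      · refine le_trans (measure_mono (ball_subset_ball' ?_)) (measure_ball_two_pow_le hs (i + 1) hpos)
        have : (2 : ℝ) ^ (i + 1) * (2 * r * (1 / 2) ^ i) = 4 * r := by
          rw [pow_succ, one_div, inv_pow]; field_simp; norm_num
        rw [this, dist_comm]
        linarith
    have hpow : ∀ i : ℕ, ((2 : ℝ≥0∞) ^ (s * (i + 1))) ^ δ = 2 ^ ((β : ℝ) / 2) * (2 ^ ((β : ℝ) / 2)) ^ i :=
      fun i => by
        rw [← pow_succ', ← ENNReal.rpow_natCast, ← ENNReal.rpow_natCast, ← ENNReal.rpow_mul,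
          ← ENNReal.rpow_mul, ← hsδ]
        congr 1
        push_cast
        ring
    have hratio : ∀ i : ℕ, ((2⁻¹ : ℝ≥0∞) ^ (β : ℝ)) ^ i * (2 ^ ((β : ℝ) / 2)) ^ i =
        ((2⁻¹ : ℝ≥0∞) ^ ((β : ℝ) / 2)) ^ i := fun i => by
      rw [← mul_pow]
      congr 1
      have h1 : (2⁻¹ : ℝ≥0∞) ^ (β : ℝ) = 2⁻¹ ^ ((β : ℝ) / 2) * 2⁻¹ ^ ((β : ℝ) / 2) := by
        rw [← ENNReal.rpow_add_of_nonneg _ _ (half_pos hβ').le (half_pos hβ').le, add_halves]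
      rw [h1, mul_assoc, ← ENNReal.mul_rpow_of_nonneg _ _ (half_pos hβ').le,
        ENNReal.inv_mul_cancel (by simp) (by simp), ENNReal.one_rpow, mul_one]
    refine (enorm_sub_average_le_tsum hs hβ hu hx).trans ?_
    calc 2 ^ (2 * s + 1) * ∑' i : ℕ, meanOsc μ u x (2 * r * (1 / 2) ^ i)
        ≤ 2 ^ (2 * s + 1) * ∑' i : ℕ, ((2⁻¹ : ℝ≥0∞) ^ ((β : ℝ) / 2)) ^ i *
            (ENNReal.ofReal (2 * r) ^ (β : ℝ) * 2 ^ ((β : ℝ) / 2) * (f x ^ (1 - q * δ) * A ^ δ)) := by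
          gcongr with i
          have hpos : 0 < 2 * r * (1 / 2) ^ i := by positivity
          calc _ ≤ ENNReal.ofReal (2 * r * (1 / 2) ^ i) ^ (β : ℝ) * (f x ^ (1 - q * δ) *
                (⨍⁻ y in ball x (2 * r * (1 / 2) ^ i), f y ^ q ∂μ) ^ δ) :=
                meanOsc_le_rpow_mul_rpow hq0 hδ0 (by linarith) hpos
            _ ≤ ENNReal.ofReal (2 * r * (1 / 2) ^ i) ^ (β : ℝ) * (f x ^ (1 - q * δ) *
                (2 ^ (s * (i + 1)) * A) ^ δ) := by
                gcongr
                exact hav i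
            _ = _ := by
                rw [ofReal_mul_half_pow_rpow (by positivity) i β.coe_nonneg,
                  ENNReal.mul_rpow_of_nonneg _ _ hδ0.le, hpow, ← hratio]
                ring
      _ = _ := by
          rw [ENNReal.tsum_mul_right, hK, ENNReal.ofReal_mul (by norm_num),
            ENNReal.mul_rpow_of_nonneg _ _ β.coe_nonneg, ENNReal.ofReal_ofNat]
          ring
  have hAt : A ≠ ∞ := by
    obtain ⟨κ, hκ⟩ := hu
    have h2κ : ((2 * κ : ℝ≥0∞)) ^ q ≠ ∞ := ENNReal.rpow_ne_top_of_nonneg hq0.le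
      (ENNReal.mul_ne_top ENNReal.ofNat_ne_top ENNReal.coe_ne_top)
    refine ne_top_of_le_ne_top h2κ (ballSup_le fun z r hr _ => ?_)
    exact setLAverage_le_of_forall_le measurableSet_ball (measure_ball_ne_zero μ hr)
      (measure_ball_ne_top μ) fun y _ =>
        ENNReal.rpow_le_rpow (oscMaximal_le_of_holderWith hβ hκ y) hq0.le
  have hAδ : (A ^ δ) ^ p ≠ ∞ := ENNReal.rpow_ne_top_of_nonneg hp.le
    (ENNReal.rpow_ne_top_of_nonneg hδ0.le hAt)
  have hc : (K * ENNReal.ofReal r ^ (β : ℝ)) ^ p ≠ ∞ := ENNReal.rpow_ne_top_of_nonneg hp.le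
    (ENNReal.mul_ne_top hKt (ofReal_rpow_ne_top β.coe_nonneg))
  calc ⨍⁻ x in ball z r, ‖u x - ⨍ w in ball z r, u w ∂μ‖ₑ ^ p ∂μ
      ≤ ⨍⁻ x in ball z r, (K * ENNReal.ofReal r ^ (β : ℝ)) ^ p * (A ^ δ) ^ p * f x ^ q ∂μ := by
        refine setLAverage_mono_on measurableSet_ball fun x hx => ?_
        refine (ENNReal.rpow_le_rpow (hpt x hx) hp.le).trans (le_of_eq ?_)
        rw [ENNReal.mul_rpow_of_nonneg _ _ hp.le, ENNReal.mul_rpow_of_nonneg _ (A ^ δ) hp.le,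
          ← ENNReal.rpow_mul (f x), hqδ]
        ring
    _ ≤ (K * ENNReal.ofReal r ^ (β : ℝ)) ^ p * (A ^ δ) ^ p * (2 ^ (s * 2) * A) := by
        rw [setLAverage_const_mul (ENNReal.mul_ne_top hc hAδ)]
        gcongr
        refine le_trans ?_ (mul_le_mul' le_rfl hA3)
        refine setLAverage_le_mul_of_subset (ball_subset_ball (by linarith))
          (measure_ball_ne_zero μ hr) (measure_ball_ne_top μ) ?_ _
        exact le_trans (measure_mono (ball_subset_ball (by linarith)))
          (measure_ball_two_pow_le hs 2 hr)
    _ = _ := by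
        rw [← hpq, ENNReal.rpow_add_of_nonneg _ _ zero_le_one (by positivity), ENNReal.rpow_one,
          ENNReal.mul_rpow_of_nonneg _ _ hp.le, ENNReal.rpow_mul A, ENNReal.rpow_mul (ENNReal.ofReal r)]
        push_cast [ENNReal.coe_rpow_of_nonneg _ hp.le, ENNReal.coe_toNNReal hKt]
        ring

end SobolevPoincare

/-! ### Radius against diameter in geodesic spaces. -/

section Geodesic

variable {X : Type*} [MetricSpace X]

theorem IsGeodesicSpace.exists_dist_eq (hX : IsGeodesicSpace X) (x y : X) {s : ℝ} (hs : 0 ≤ s)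
    (hsd : s ≤ dist x y) : ∃ w, dist x w = s := by
  rcases eq_or_ne x y with rfl | hxy
  · exact ⟨x, by rw [dist_self] at hsd ⊢; linarith⟩
  obtain ⟨a, b, γ, hab, hγ, rfl, rfl, -⟩ := hX x y hxy
  have hc : ContinuousOn (fun t => dist (γ a) (γ t)) (Icc a b) :=
    (continuous_const.dist continuous_id).comp_continuousOn hγ
  obtain ⟨t, -, ht⟩ := intermediate_value_Icc hab hc (show s ∈ Icc _ _ by simpa using ⟨hs, hsd⟩)
  exact ⟨γ t, ht⟩

/-- A ball that is not the whole space contains a point at distance r/2 from its center. If it is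
the whole space, the radius can be lowered to twice the diameter. This allows the radius to be
replaced by the diameter in the Sobolev–Poincaré inequality. -/
theorem IsGeodesicSpace.exists_ball_eq (hX : IsGeodesicSpace X) [Nontrivial X] (z : X) {r : ℝ}
    (hr : 0 < r) : ∃ r', 0 < r' ∧ ball z r' = ball z r ∧ r' ≤ 2 * diam (ball z r) := by
  by_cases h : ∃ y, r ≤ dist z y
  · obtain ⟨y, hy⟩ := h
    obtain ⟨w, hw⟩ := hX.exists_dist_eq z y (half_pos hr).le (by linarith)
    refine ⟨r, hr, rfl, ?_⟩
    have hwB : w ∈ ball z r := by rw [mem_ball, dist_comm, hw]; linarith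
    have := dist_le_diam_of_mem isBounded_ball (mem_ball_self hr) hwB
    linarith
  · push Not at h
    have huniv : ∀ y, y ∈ ball z r := fun y => by rw [mem_ball, dist_comm]; exact h y
    obtain ⟨x, y, hxy⟩ := exists_pair_ne X
    have hpos : 0 < diam (ball z r) :=
      (dist_pos.2 hxy).trans_le (dist_le_diam_of_mem isBounded_ball (huniv x) (huniv y))
    refine ⟨2 * diam (ball z r), by positivity, ?_, le_rfl⟩
    ext y
    refine iff_of_true ?_ (huniv y)
    have := dist_le_diam_of_mem isBounded_ball (huniv y) (mem_ball_self hr)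
    rw [mem_ball]
    linarith

variable [MeasurableSpace X] [BorelSpace X] {β : ℝ≥0}

theorem IsGeodesicSpace.exists_lintegral_sharpMaximal_rpow_le (hX : IsGeodesicSpace X)
    (μ : Measure X) [hμ : IsDoublingSpace μ] (hβ : 0 < β) {p : ℝ} (hp : 0 < p) :
    ∃ C : ℝ≥0, ∀ u : X → ℝ, MemHolder β u →
      ∫⁻ x, sharpMaximal μ p β u x ^ p ∂μ ≤ C * ∫⁻ x, oscMaximal μ β u x ^ p ∂μ := by
  have := hμ.nontrivial
  obtain ⟨C, q, hq, hqp, hC⟩ := exists_setLAverage_rpow_le_maximalFunction μ hβ hp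
  obtain ⟨C', hC'⟩ := exists_lintegral_maximalFunction_rpow_le μ ((one_lt_div hq).2 hqp)
  have hβp : 0 ≤ (β : ℝ) * p := by positivity
  refine ⟨C * 2 ^ ((β : ℝ) * p) * C', fun u hu => ?_⟩
  set f := oscMaximal μ β u with hf
  have hfm : Measurable f := measurable_ballSup _
  have hpt : ∀ x, sharpMaximal μ p β u x ^ p ≤
      C * 2 ^ ((β : ℝ) * p) * maximalFunction μ (fun x => f x ^ q) x ^ (p / q) := fun x => by
    rw [← ENNReal.le_rpow_inv_iff hp, ← one_div]
    refine iSup_le fun z => iSup_le fun r => iSup_le fun hr => iSup_le fun hx => ?_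
    obtain ⟨r', hr', hball, hdiam⟩ := hX.exists_ball_eq z hr
    have hd : 0 < diam (ball z r) := by linarith
    have h := hC u hu z r' x (by rwa [hball])
    rw [hball] at h
    refine ENNReal.rpow_le_rpow ?_ (by positivity)
    rw [ENNReal.div_le_iff (ofReal_rpow_ne_zero hd) (ofReal_rpow_ne_top hβp)]
    refine h.trans ?_
    calc _ ≤ C * (2 ^ ((β : ℝ) * p) * ENNReal.ofReal (diam (ball z r)) ^ ((β : ℝ) * p)) *
          maximalFunction μ (fun x => f x ^ q) x ^ (p / q) := by
          gcongr
          rw [← ENNReal.ofReal_ofNat, ← ENNReal.mul_rpow_of_nonneg _ _ hβp,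
            ← ENNReal.ofReal_mul (by norm_num)]
          exact ENNReal.rpow_le_rpow (ENNReal.ofReal_le_ofReal hdiam) hβp
      _ = _ := by ring
  have hKt : (C * 2 ^ ((β : ℝ) * p) : ℝ≥0∞) ≠ ∞ := ENNReal.mul_ne_top ENNReal.coe_ne_top
    (ENNReal.rpow_ne_top_of_nonneg hβp ENNReal.ofNat_ne_top)
  calc ∫⁻ x, sharpMaximal μ p β u x ^ p ∂μ
      ≤ ∫⁻ x, C * 2 ^ ((β : ℝ) * p) * maximalFunction μ (fun x => f x ^ q) x ^ (p / q) ∂μ :=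
        lintegral_mono hpt
    _ = C * 2 ^ ((β : ℝ) * p) * ∫⁻ x, maximalFunction μ (fun x => f x ^ q) x ^ (p / q) ∂μ :=
        lintegral_const_mul' _ _ hKt
    _ ≤ C * 2 ^ ((β : ℝ) * p) * (C' * ∫⁻ x, (f x ^ q) ^ (p / q) ∂μ) :=
        mul_le_mul' le_rfl (hC' _ (hfm.pow_const q))
    _ = _ := by
        simp only [← ENNReal.rpow_mul, mul_div_cancel₀ p hq.ne']
        push_cast [ENNReal.coe_rpow_of_nonneg _ hβp]
        ring

end Geodesic

/-! ### Comparison of Sobolev norms and of the completions. -/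

namespace DStructure

variable {X : Type*} [MetricSpace X] [MeasurableSpace X] {μ : Measure X} {p : ℝ} {β : ℝ≥0}

theorem sobolevNorm_le_mul_of_forall_exists (D D' : DStructure μ p β) {C : ℝ≥0} (hC : 1 ≤ C)
    {u : X → ℝ} (hu : MemHolder β u)
    (h : ∀ g ∈ D.toFun u, ∃ g' ∈ D'.toFun u, ∫⁻ x, g' x ^ p ∂μ ≤ C * ∫⁻ x, g x ^ p ∂μ) :
    D'.sobolevNorm u ≤ C * D.sobolevNorm u := by
  have hp := D.p_pos
  have hC0 : (C : ℝ≥0∞) ≠ 0 := by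
    exact_mod_cast (zero_lt_one.trans_le hC).ne'
  have hC1 : (1 : ℝ≥0∞) ≤ C := by exact_mod_cast hC
  -- As C ≥ 1 and p ≥ 1, the p-th root can be dropped.
  have hCp : (C : ℝ≥0∞) ^ (1 / p) ≤ C := by
    have : 1 / p ≤ 1 := by rw [div_le_one hp]; exact D.one_le_p
    simpa using ENNReal.rpow_le_rpow_of_exponent_le hC1 this
  rw [mul_comm, ← ENNReal.div_le_iff hC0 ENNReal.coe_ne_top]
  refine le_of_forall_gt_imp_ge_of_dense fun c hc => ?_
  rw [ENNReal.div_le_iff hC0 ENNReal.coe_ne_top, mul_comm]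
  obtain ⟨g, hg, hgc⟩ := D.exists_lt hu hc
  obtain ⟨g', hg', hle⟩ := h g hg
  calc D'.sobolevNorm u ≤ (∫⁻ x, ‖u x‖ₑ ^ p ∂μ + ∫⁻ x, g' x ^ p ∂μ) ^ (1 / p) :=
        D'.sobolevNorm_le hg'
    _ ≤ (C * ∫⁻ x, ‖u x‖ₑ ^ p ∂μ + C * ∫⁻ x, g x ^ p ∂μ) ^ (1 / p) := by
        refine ENNReal.rpow_le_rpow (add_le_add ?_ hle) (by positivity)
        exact le_mul_of_one_le_left' hC1
    _ = (C : ℝ≥0∞) ^ (1 / p) * (∫⁻ x, ‖u x‖ₑ ^ p ∂μ + ∫⁻ x, g x ^ p ∂μ) ^ (1 / p) := by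
        rw [← mul_add, ENNReal.mul_rpow_of_nonneg _ _ (by positivity)]
    _ ≤ C * c := by gcongr

variable [BorelSpace X]

/-- On the Hölder functions every `𝒟`-structure dominates the Hajłasz structure. -/
theorem exists_hajlasz_sobolevNorm_le [IsDoublingSpace μ] (D : DStructure μ p β) (hp : 1 < p)
    (hβ : 0 < β) (hβ1 : β ≤ 1) :
    ∃ C : ℝ≥0, 1 ≤ C ∧ ∀ u : X → ℝ, MemHolder β u →
      (hajlaszStructure μ p β hp.le hβ hβ1).sobolevNorm u ≤ C * D.sobolevNorm u := by
  have hp0 := D.p_pos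
  obtain ⟨C, -, hC⟩ := D.exists_lintegral_oscMaximal_rpow_le hp
  obtain ⟨C₁, hC₁⟩ := exists_edist_le_oscMaximal μ hβ
  refine ⟨1 + C₁ ^ p * C, le_self_add, fun u hu => ?_⟩
  refine D.sobolevNorm_le_mul_of_forall_exists _ le_self_add hu fun g hg => ?_
  have hm : Measurable (oscMaximal μ β u) := measurable_ballSup _
  refine ⟨fun x => C₁ * oscMaximal μ β u x, ⟨(hm.const_mul _).aemeasurable, ∅, measure_empty,
    fun x _ y _ => (hC₁ u hu x y).trans (le_of_eq (by ring))⟩, ?_⟩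
  simp only [ENNReal.mul_rpow_of_nonneg _ _ hp0.le]
  rw [lintegral_const_mul' _ _ (ENNReal.rpow_ne_top_of_nonneg hp0.le ENNReal.coe_ne_top)]
  calc _ ≤ (C₁ : ℝ≥0∞) ^ p * (C * ∫⁻ x, g x ^ p ∂μ) := mul_le_mul' le_rfl (hC u hu g hg)
    _ = (C₁ : ℝ≥0∞) ^ p * C * ∫⁻ x, g x ^ p ∂μ := by ring
    _ ≤ _ := by
        gcongr
        push_cast [ENNReal.coe_rpow_of_nonneg _ hp0.le]
        exact le_add_self

/-- If a multiple of the sharp maximal function of `u` belongs to `𝒟(u)` for every `u`, then the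
Sobolev norm is dominated by that of every other `𝒟`-structure. -/
theorem exists_sobolevNorm_le_of_sharpMaximal_mem [IsDoublingSpace μ] (hX : IsGeodesicSpace X)
    (D A : DStructure μ p β) (hp : 1 < p) (η : ℝ)
    (hA : ∀ u : X → ℝ, MemHolder β u →
      (fun x => ENNReal.ofReal η * sharpMaximal μ p β u x) ∈ A.toFun u) :
    ∃ C : ℝ≥0, 1 ≤ C ∧ ∀ u : X → ℝ, MemHolder β u → A.sobolevNorm u ≤ C * D.sobolevNorm u := by
  have hp0 := D.p_pos
  obtain ⟨C, -, hC⟩ := D.exists_lintegral_oscMaximal_rpow_le hp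
  obtain ⟨C₁, hC₁⟩ := hX.exists_lintegral_sharpMaximal_rpow_le μ D.beta_pos hp0
  refine ⟨1 + η.toNNReal ^ p * C₁ * C, le_self_add, fun u hu => ?_⟩
  refine D.sobolevNorm_le_mul_of_forall_exists _ le_self_add hu fun g hg => ⟨_, hA u hu, ?_⟩
  simp only [ENNReal.mul_rpow_of_nonneg _ _ hp0.le]
  rw [lintegral_const_mul' _ _ (ENNReal.rpow_ne_top_of_nonneg hp0.le ENNReal.ofReal_ne_top)]
  calc _ ≤ ENNReal.ofReal η ^ p * (C₁ * (C * ∫⁻ x, g x ^ p ∂μ)) :=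
        mul_le_mul' le_rfl ((hC₁ u hu).trans (mul_le_mul' le_rfl (hC u hu g hg)))
    _ = ENNReal.ofReal η ^ p * C₁ * C * ∫⁻ x, g x ^ p ∂μ := by ring
    _ ≤ _ := by
        gcongr
        push_cast [ENNReal.coe_rpow_of_nonneg _ hp0.le]
        exact le_add_self

theorem holderSubmodule_le_of_sobolevNorm_le {D D' : DStructure μ p β} {C : ℝ≥0}
    (h : ∀ u : X → ℝ, MemHolder β u → D'.sobolevNorm u ≤ C * D.sobolevNorm u) :
    D.holderSubmodule ≤ D'.holderSubmodule := fun u hu =>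
  ⟨hu.1, (h u hu.1).trans_lt (ENNReal.mul_lt_top ENNReal.coe_lt_top hu.2)⟩

variable [μ.IsOpenPosMeasure]

/-- The inclusion of the normed spaces of Hölder functions when one norm dominates the other. -/
noncomputable def HolderSobolev.inclusion {D D' : DStructure μ p β} {C : ℝ≥0}
    (h : ∀ u : X → ℝ, MemHolder β u → D'.sobolevNorm u ≤ C * D.sobolevNorm u) :
    D.HolderSobolev →L[ℝ] D'.HolderSobolev :=
  LinearMap.mkContinuous
    { toFun := fun u => HolderSobolev.mk D' u.1 (holderSubmodule_le_of_sobolevNorm_le h u.2)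
      map_add' := fun _ _ => rfl
      map_smul' := fun _ _ => rfl } C fun u => by
    change (D'.sobolevNorm u.1).toReal ≤ C * (D.sobolevNorm u.1).toReal
    rw [← ENNReal.coe_toReal, ← ENNReal.toReal_mul]
    exact ENNReal.toReal_mono (ENNReal.mul_ne_top ENNReal.coe_ne_top u.2.2.ne) (h u.1 u.2.1)

/-- The composition is the identity on the dense subspace of Hölder functions, hence everywhere by
continuity. -/
theorem HolderSobolev.completion_inclusion_inclusion {D D' : DStructure μ p β} {C C' : ℝ≥0}
    (h : ∀ u : X → ℝ, MemHolder β u → D'.sobolevNorm u ≤ C * D.sobolevNorm u)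
    (h' : ∀ u : X → ℝ, MemHolder β u → D.sobolevNorm u ≤ C' * D'.sobolevNorm u)
    (x : D.SobolevSpace) :
    (HolderSobolev.inclusion h').completion ((HolderSobolev.inclusion h).completion x) = x := by
  induction x using UniformSpace.Completion.induction_on with
  | hp => exact isClosed_eq (by fun_prop) continuous_id
  | ih u =>
    rw [ContinuousLinearMap.completion_apply_coe, ContinuousLinearMap.completion_apply_coe]
    rfl

/-- The isomorphism of Sobolev spaces whose norms are equivalent on the Hölder functions. -/
noncomputable def SobolevSpace.equiv {D D' : DStructure μ p β} {C C' : ℝ≥0}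
    (h : ∀ u : X → ℝ, MemHolder β u → D'.sobolevNorm u ≤ C * D.sobolevNorm u)
    (h' : ∀ u : X → ℝ, MemHolder β u → D.sobolevNorm u ≤ C' * D'.sobolevNorm u) :
    D.SobolevSpace ≃L[ℝ] D'.SobolevSpace :=
  ContinuousLinearEquiv.equivOfInverse (HolderSobolev.inclusion h).completion
    (HolderSobolev.inclusion h').completion
    (HolderSobolev.completion_inclusion_inclusion h h')
    (HolderSobolev.completion_inclusion_inclusion h' h)

theorem SobolevSpace.equiv_ofHolder {D D' : DStructure μ p β} {C C' : ℝ≥0}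
    (h : ∀ u : X → ℝ, MemHolder β u → D'.sobolevNorm u ≤ C * D.sobolevNorm u)
    (h' : ∀ u : X → ℝ, MemHolder β u → D.sobolevNorm u ≤ C' * D'.sobolevNorm u) (u : X → ℝ)
    (hu : u ∈ D.holderSubmodule) (hu' : u ∈ D'.holderSubmodule) :
    SobolevSpace.equiv h h' (D.ofHolder u hu) = D'.ofHolder u hu' :=
  ContinuousLinearMap.completion_apply_coe (HolderSobolev.inclusion h) (HolderSobolev.mk D u hu)

/-- A continuous linear equivalence of Sobolev spaces is determined by its values at the Hölder
functions. -/
theorem SobolevSpace.equiv_ext {D D' : DStructure μ p β} {Φ Ψ : D.SobolevSpace ≃L[ℝ] D'.SobolevSpace}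
    (h : ∀ (u : X → ℝ) (hu : u ∈ D.holderSubmodule), Φ (D.ofHolder u hu) = Ψ (D.ofHolder u hu)) :
    Φ = Ψ := by
  ext x
  induction x using UniformSpace.Completion.induction_on with
  | hp => exact isClosed_eq Φ.continuous Ψ.continuous
  | ih u => exact h u.1 u.2

end DStructure

/-! ### The main theorem. -/

theorem corollaryc {X : Type*} [MetricSpace X] [MeasurableSpace X] [BorelSpace X]
    (μ : Measure X) [IsDoublingSpace μ] (hX : IsGeodesicSpace X)
    (p : ℝ) (hp : 1 < p) (β : ℝ≥0) (hβ : 0 < β) (hβ1 : β ≤ 1)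
    (A : DStructure μ p β) (η : ℝ) (hη : 0 < η)
    (hA : ∀ u : X → ℝ, MemHolder β u →
      (fun x => ENNReal.ofReal η * sharpMaximal μ p β u x) ∈ A.toFun u) :
    (∃ C : ℝ≥0, 1 ≤ C ∧ ∀ u : X → ℝ, MemHolder β u →
      (C : ℝ≥0∞)⁻¹ * A.sobolevNorm u ≤ (hajlaszStructure μ p β hp.le hβ hβ1).sobolevNorm u ∧
      (hajlaszStructure μ p β hp.le hβ hβ1).sobolevNorm u ≤ C * A.sobolevNorm u) ∧
    A.holderSubmodule = (hajlaszStructure μ p β hp.le hβ hβ1).holderSubmodule ∧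
    ∃! Φ : A.SobolevSpace ≃L[ℝ] (hajlaszStructure μ p β hp.le hβ hβ1).SobolevSpace,
      ∀ (u : X → ℝ) (hu : u ∈ A.holderSubmodule)
        (hu' : u ∈ (hajlaszStructure μ p β hp.le hβ hβ1).holderSubmodule),
        Φ (A.ofHolder u hu) = (hajlaszStructure μ p β hp.le hβ hβ1).ofHolder u hu' := by
  obtain ⟨C₁, hC₁, h₁⟩ := A.exists_hajlasz_sobolevNorm_le hp hβ hβ1
  -- Here the estimate for the sharp maximal function is applied to the Hajłasz structure itself.
  obtain ⟨C₂, hC₂, h₂⟩ := DStructure.exists_sobolevNorm_le_of_sharpMaximal_mem hX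
    (hajlaszStructure μ p β hp.le hβ hβ1) A hp η hA
  refine ⟨⟨max C₁ C₂, le_max_of_le_left hC₁, fun u hu => ⟨?_, ?_⟩⟩, ?_, ?_⟩
  · have hC0 : ((max C₁ C₂ : ℝ≥0) : ℝ≥0∞) ≠ 0 := by
      exact_mod_cast (zero_lt_one.trans_le (le_max_of_le_left hC₁)).ne'
    rw [mul_comm, ← div_eq_mul_inv, ENNReal.div_le_iff hC0 ENNReal.coe_ne_top, mul_comm]
    exact (h₂ u hu).trans (mul_le_mul' (by exact_mod_cast le_max_right _ _) le_rfl)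
  · exact (h₁ u hu).trans (mul_le_mul' (by exact_mod_cast le_max_left _ _) le_rfl)
  · exact le_antisymm (DStructure.holderSubmodule_le_of_sobolevNorm_le h₁)
      (DStructure.holderSubmodule_le_of_sobolevNorm_le h₂)
  · refine ⟨DStructure.SobolevSpace.equiv h₁ h₂,
      fun u hu hu' => DStructure.SobolevSpace.equiv_ofHolder h₁ h₂ u hu hu', fun Ψ hΨ => ?_⟩
    refine DStructure.SobolevSpace.equiv_ext fun u hu => ?_
    have hu' := DStructure.holderSubmodule_le_of_sobolevNorm_le h₁ hu
    rw [hΨ u hu hu', DStructure.SobolevSpace.equiv_ofHolder h₁ h₂ u hu hu']
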